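/- Let $\mathcal H$ be a complex Hilbert space and let $\mathcal V,\mathcal W\subset\mathcal H$ be finite dimensional subspaces with $\mathcal V\oplus\mathcal W^\perp=\mathcal H$ (algebraic direct sum) and $d=\dim\mathcal V=\dim\mathcal W$. For a positive finite rank operator $S$ on $\mathcal H$ let $\lambda(S)=(\lambda_1(S),\lambda_2(S),\dots)$ be the list of the eigenvalues of the compression of $S$ to its range, counted with multiplicity and in non-increasing order, followed by zeros. Let $P_{\mathcal V},P_{\mathcal W}$ be the orthogonal projections, and let $P_{\mathcal V/\!/\mathcal W^\perp}$ be the oblique projection with range $\mathcal V$ and kernel $\mathcal W^\perp$. The principal angles $\theta_1\le\dots\le\theta_d$ in $[0,\pi/2]$ between $\mathcal V$ and $\mathcal W$ are given by $\cos\theta_j=\lambda_j(|P_{\mathcal W}P_{\mathcal V}|)$, and an orthonormal basis $\{w_j\}_{j=1}^d$ of $\mathcal W$ is said to consist of principal vectors between $\mathcal V$ and $\mathcal W$ if $|P_{\mathcal V}P_{\mathcal W}|\,w_j=\cos(\theta_j)\,w_j$ for $1\le j\le d$. Let $\mathcal F=\{f_i\}_{i=1}^n\subset\mathcal W$ be a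 frame for $\mathcal W$, that is, $A\|x\|^2\le\sum_i|\langle x,f_i\rangle|^2\le B\|x\|^2$ for all $x\in\mathcal W$ and some constants $0<A<B$. For a finite sequence $\mathcal G=\{g_i\}_{i=1}^n$ in $\mathcal H$ let $S_{\mathcal G}=T_{\mathcal G}T_{\mathcal G}^*$ be its frame operator, where $T_{\mathcal G}:\mathbb C^n\to\mathcal H$, $T_{\mathcal G}a=\sum_i a_ig_i$. Let $S_{\mathcal F}^\dagger$ be the Moore-Penrose pseudo-inverse of $S_{\mathcal F}$ and let $\mathcal F^\#_{\mathcal V}=\{P_{\mathcal V/\!/\mathcal W^\perp}S_{\mathcal F}^\dagger f_i\}_{i=1}^n$ be the canonical $\mathcal V$-dual of $\mathcal F$. Write $\lambda=\lambda(S_{\mathcal F})$ and $\lambda^\#_{\mathcal V}=\lambda(S_{\mathcal F^\#_{\mathcal V}})$. Then $\lambda_j>0$ and $0\le\theta_j<\pi/2$ for $1\le j\le d$. Let $\mu=(\mu_1,\dots,\mu_d)$ be the non-increasing rearrangement of $\big(\lambda_{d-j+1}^{-1}\cos^{-2}(\theta_j)\big)_{j=1}^d$. Then, for $1\le k\le d$,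 $$\prod_{j=1}^k\mu_j\ \le\ \prod_{j=1}^k\lambda^\#_{\mathcal V,j}\ \le\ \Big(\prod_{j=d-k+1}^d\lambda_j\cos^2(\theta_j)\Big)^{-1}.$$ Moreover: 1. $\lambda^\#_{\mathcal V}=(\mu,0,0,\dots)$ if and only if there is an orthonormal basis $\{w_j\}_{j=1}^d$ of $\mathcal W$ of principal vectors between $\mathcal V$ and $\mathcal W$ such that $S_{\mathcal F}=\sum_{j=1}^d\lambda_{d-j+1}\,w_j\otimes w_j$; 2. $\lambda^\#_{\mathcal V}=(\nu,0,0,\dots)$, where $\nu_j=\lambda_{d-j+1}^{-1}\cos^{-2}(\theta_{d-j+1})$ for $1\le j\le d$, if and only if there is an orthonormal basis $\{w_j\}_{j=1}^d$ of $\mathcal W$ of principal vectors between $\mathcal V$ and $\mathcal W$ such that $S_{\mathcal F}=\sum_{j=1}^d\lambda_j\,w_j\otimes w_j$. Here $w\otimes w$ is the operator $x\mapsto\langle x,w\rangle\,w$. -/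

import Mathlib

namespace ObliqueDuality

open scoped InnerProductSpace

noncomputable section

variable {H : Type*} [NormedAddCommGroup H] [InnerProductSpace ℂ H]

/-! Eigenvalue lists of positive finite rank operators -/

/-- The compression of `S` to the subspace `K`, as an operator on `K`. -/
def compression (S : H →L[ℂ] H) (K : Submodule ℂ H) [K.HasOrthogonalProjection] : K →ₗ[ℂ] K :=
  (K.orthogonalProjectionOnto : H →ₗ[ℂ] K) ∘ₗ (S : H →ₗ[ℂ] H) ∘ₗ K.subtype

theorem compression_isSymmetric {S : H →L[ℂ] H} (hS : (S : H →ₗ[ℂ] H).IsSymmetric)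
    (K : Submodule ℂ H) [K.HasOrthogonalProjection] : (compression S K).IsSymmetric := by
  intro x y
  have h := hS (x : H) (y : H)
  simpa [compression] using h

open Classical in
/-- The eigenvalue list `λ(S)` of a positive finite rank operator `S` on a (possibly infinite
dimensional) space: the eigenvalues of the compression of `S` to its range, counting
multiplicities and in non-increasing order, followed by zeros. Indices start at `0`. (For
operators that are not symmetric or not of finite rank, the value is `0` by convention.) -/
def eigenvalueList (S : H →L[ℂ] H) (i : ℕ) : ℝ :=
  if h : (S : H →ₗ[ℂ] H).IsSymmetric ∧ FiniteDimensional ℂ (S : H →ₗ[ℂ] H).range then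
    haveI := h.2
    if hi : i < Module.finrank ℂ (S : H →ₗ[ℂ] H).range then
      (compression_isSymmetric h.1 (S : H →ₗ[ℂ] H).range).eigenvalues rfl ⟨i, hi⟩
    else 0
  else 0

/-- The non-increasing rearrangement of a vector. -/
def decreasingRearrangement {d : ℕ} (x : Fin d → ℝ) : Fin d → ℝ :=
  fun j => x (Tuple.sort x j.rev)

/-- The vector `x` followed by zeros. -/
def zeroPad {d : ℕ} (x : Fin d → ℝ) (i : ℕ) : ℝ :=
  if h : i < d then x ⟨i, h⟩ else 0

/-! Finite frames and oblique duals -/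

/-- The finite sequence `f` consists of vectors of `W` and is a frame for `W`. -/
def IsFrameFor {n : ℕ} (W : Submodule ℂ H) (f : Fin n → H) : Prop :=
  (∀ i, f i ∈ W) ∧ ∃ A B : ℝ, 0 < A ∧ A < B ∧
    ∀ x ∈ W, A * ‖x‖ ^ 2 ≤ ∑ i, ‖⟪f i, x⟫_ℂ‖ ^ 2 ∧ ∑ i, ‖⟪f i, x⟫_ℂ‖ ^ 2 ≤ B * ‖x‖ ^ 2

/-- The synthesis operator `a ↦ ∑ i, a i • f i`. -/
def synthesis {n : ℕ} (f : Fin n → H) : EuclideanSpace ℂ (Fin n) →L[ℂ] H :=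
  ∑ i, (EuclideanSpace.proj (𝕜 := ℂ) i).smulRight (f i)

/-- The frame operator: synthesis composed with its adjoint, the analysis operator. -/
def frameOperator [CompleteSpace H] {n : ℕ} (f : Fin n → H) : H →L[ℂ] H :=
  synthesis f ∘L (synthesis f).adjoint

/-- The four Penrose equations: `X` is the Moore-Penrose pseudo-inverse of `S`. -/
structure IsPseudoinverse [CompleteSpace H] (S X : H →L[ℂ] H) : Prop where
  mul_mul_self : S * X * S = S
  self_mul_mul : X * S * X = X
  isSelfAdjoint_left : IsSelfAdjoint (S * X)
  isSelfAdjoint_right : IsSelfAdjoint (X * S)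

theorem IsPseudoinverse.unique [CompleteSpace H] {S X Y : H →L[ℂ] H}
    (hX : IsPseudoinverse S X) (hY : IsPseudoinverse S Y) : X = Y := by
  have h1 : S * X = S * Y := by
    calc S * X = star (S * X) := hX.isSelfAdjoint_left.star_eq.symm
      _ = star ((S * Y) * (S * X)) := by rw [← mul_assoc, hY.mul_mul_self]
      _ = (S * X) * (S * Y) := by
        rw [star_mul, hX.isSelfAdjoint_left.star_eq, hY.isSelfAdjoint_left.star_eq]
      _ = S * Y := by rw [← mul_assoc, hX.mul_mul_self]
  have h2 : X * S = Y * S := by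
    calc X * S = star (X * S) := hX.isSelfAdjoint_right.star_eq.symm
      _ = star ((X * S) * (Y * S)) := by rw [mul_assoc, ← mul_assoc S Y S, hY.mul_mul_self]
      _ = (Y * S) * (X * S) := by
        rw [star_mul, hX.isSelfAdjoint_right.star_eq, hY.isSelfAdjoint_right.star_eq]
      _ = Y * S := by rw [mul_assoc, ← mul_assoc S X S, hX.mul_mul_self]
  calc X = X * S * X := hX.self_mul_mul.symm
    _ = Y * S * Y := by rw [h2, mul_assoc, h1, ← mul_assoc]
    _ = Y := hY.self_mul_mul

open Classical in
/-- The Moore-Penrose pseudo-inverse `S†` of an operator `S` with closed range (and `0` by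
convention for operators without a bounded pseudo-inverse). -/
def pseudoinverse [CompleteSpace H] (S : H →L[ℂ] H) : H →L[ℂ] H :=
  if h : ∃ X, IsPseudoinverse S X then h.choose else 0

/-- The canonical `V`-dual `P_{V // Wᗮ} S† f i` of the frame `f` for `W`, where
`P_{V // Wᗮ}` is the oblique projection with range `V` and kernel `Wᗮ`. -/
def canonicalDual [CompleteSpace H] {n : ℕ} {V W : Submodule ℂ H} (hVW : IsCompl V Wᗮ)
    (f : Fin n → H) : Fin n → H :=
  fun i => V.projection Wᗮ hVW (pseudoinverse (frameOperator f) (f i))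

/-! Principal angles and principal vectors -/

/-- The principal angles between `V` and `W`, in non-decreasing order and with indices starting
at `0`: their cosines are the eigenvalues of `|P_W P_V|`, in non-increasing order. -/
def principalAngle [CompleteSpace H] (V W : Submodule ℂ H)
    [V.HasOrthogonalProjection] [W.HasOrthogonalProjection] (j : ℕ) : ℝ :=
  Real.arccos (eigenvalueList (CFC.abs (W.starProjection * V.starProjection)) j)

/-- The orthonormal basis `w` of `W` consists of principal vectors between `V` and `W`:
`|P_V P_W| w j = cos θ j • w j`. -/
def IsPrincipalBasis [CompleteSpace H] (V W : Submodule ℂ H)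
    [V.HasOrthogonalProjection] [W.HasOrthogonalProjection] {d : ℕ}
    (w : OrthonormalBasis (Fin d) ℂ W) : Prop :=
  ∀ j : Fin d, CFC.abs (V.starProjection * W.starProjection) (w j : H) =
    ((Real.cos (principalAngle V W j) : ℝ) : ℂ) • (w j : H)

end

end ObliqueDuality

namespace ObliqueDuality

open scoped InnerProductSpace ComplexOrder
open Matrix

/-! Comparison of ordered eigenvalues -/

section Comparison

variable {E : Type*} [NormedAddCommGroup E] [InnerProductSpace ℂ E] {d : ℕ}

/-! Orthonormal bases of `W` and `V` turn everything into matrices. Let `J_W`, `J_V` be the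
isometric embeddings, `G = J_W* J_V` the cross Gram matrix and `s` the positive definite matrix of
the frame operator. Since `V` meets `Wᗮ` trivially, `G` is invertible. The oblique projection is
`J_V G⁻¹ J_W*`, so the frame operator of the canonical dual has matrix `G⁻¹ s⁻¹ (G⁻¹)ᴴ` on `V`
(`frameOperator_canonicalDual`). The squared cosines of the principal angles are the eigenvalues of
`G Gᴴ`, equivalently of `Gᴴ G`.

Both product bounds come from one multiplicative Lidskii inequality for a congruence `Mᴴ X M`
(`prod_eigenvalues_congruence_le`). Applied to the congruence producing the dual matrix from `s⁻¹`,
it gives the upper bound. Applied to the reverse congruence, which recovers `s⁻¹` from the dual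
matrix, it gives the lower bound.

The equality cases only need the trace. The dual matrix has the trace of `s⁻¹ (G Gᴴ)⁻¹`, and the two
extremal lists give this trace its least and greatest values allowed by von Neumann's inequality.
Equality there forces simultaneous diagonalization with matched orderings
(`exists_diagonalizes_of_trace_eq`), and a common eigenbasis of `s` and `G Gᴴ` is exactly a basis of
principal vectors diagonalizing the frame operator (`exists_isPrincipalBasis_iff`). -/

theorem re_inner_apply_eq_sum {T : E →ₗ[ℂ] E} (u : OrthonormalBasis (Fin d) ℂ E) {a : Fin d → ℝ}
    (hT : ∀ i, T (u i) = (a i : ℂ) • u i) (x : E) :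
    (⟪x, T x⟫_ℂ).re = ∑ i, a i * ‖⟪u i, x⟫_ℂ‖ ^ 2 := by
  have h1 : T x = ∑ i, (⟪u i, x⟫_ℂ * a i) • u i := by
    conv_lhs => rw [← u.sum_repr' x]
    simp only [map_sum, map_smul, hT, smul_smul]
  rw [h1, inner_sum, Complex.re_sum]
  refine Finset.sum_congr rfl fun i _ => ?_
  rw [inner_smul_right, mul_right_comm, ← inner_conj_symm x (u i), RCLike.mul_conj, mul_comm]
  simp [← Complex.ofReal_pow]

/-- Weyl's monotonicity principle: larger operators have larger ordered eigenvalues. -/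
theorem eigenvalue_mono {T T' : E →ₗ[ℂ] E} (u u' : OrthonormalBasis (Fin d) ℂ E)
    {a a' : Fin d → ℝ} (ha : Antitone a) (ha' : Antitone a')
    (hT : ∀ i, T (u i) = (a i : ℂ) • u i) (hT' : ∀ i, T' (u' i) = (a' i : ℂ) • u' i)
    (hle : ∀ x, (⟪x, T x⟫_ℂ).re ≤ (⟪x, T' x⟫_ℂ).re) (i : Fin d) : a i ≤ a' i := by
  have : FiniteDimensional ℂ E := u.toBasis.finiteDimensional_of_finite
  have hdim : Module.finrank ℂ E = d := by
    simpa using Module.finrank_eq_card_basis u.toBasis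
  -- Courant–Fischer: on `P` the form of `T` is at least `a i`, on `P'` that of `T'` is at most `a'
  -- i`. The dimensions `i + 1` and `d - i` add up to more than `d`, so the two spans share a
  -- nonzero vector.
  let P := Submodule.span ℂ (Set.range fun j : Finset.Iic i => u j)
  let P' := Submodule.span ℂ (Set.range fun j : Finset.Ici i => u' j)
  have hP : Module.finrank ℂ P = i + 1 := by
    have := finrank_span_eq_card
      (u.orthonormal.linearIndependent.comp (fun j : Finset.Iic i => (j : Fin d))
        Subtype.val_injective)
    rw [Fintype.card_coe, Fin.card_Iic] at this
    exact this
  have hP' : Module.finrank ℂ P' = d - i := by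
    have := finrank_span_eq_card
      (u'.orthonormal.linearIndependent.comp (fun j : Finset.Ici i => (j : Fin d))
        Subtype.val_injective)
    rw [Fintype.card_coe, Fin.card_Ici] at this
    exact this
  have hinf : 0 < Module.finrank ℂ (P ⊓ P' : Submodule ℂ E) := by
    have h1 := Submodule.finrank_sup_add_finrank_inf_eq P P'
    have h2 := Submodule.finrank_le (P ⊔ P')
    have := i.2
    omega
  obtain ⟨⟨x, hxP, hxP'⟩, hx0⟩ := Module.finrank_pos_iff_exists_ne_zero.1 hinf
  have hx : x ≠ 0 := fun h => hx0 (by simp [h])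
  have hz : ∀ j, i < j → ⟪u j, x⟫_ℂ = 0 := by
    intro j hj
    have : P ≤ (ℂ ∙ u j)ᗮ := by
      refine Submodule.span_le.2 ?_
      rintro _ ⟨k, rfl⟩
      rw [SetLike.mem_coe, Submodule.mem_orthogonal_singleton_iff_inner_right]
      exact u.orthonormal.2 (ne_of_gt (lt_of_le_of_lt (Finset.mem_Iic.1 k.2) hj))
    exact (Submodule.mem_orthogonal_singleton_iff_inner_right).1 (this hxP)
  have hz' : ∀ j, j < i → ⟪u' j, x⟫_ℂ = 0 := by
    intro j hj
    have : P' ≤ (ℂ ∙ u' j)ᗮ := by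
      refine Submodule.span_le.2 ?_
      rintro _ ⟨k, rfl⟩
      rw [SetLike.mem_coe, Submodule.mem_orthogonal_singleton_iff_inner_right]
      exact u'.orthonormal.2 (ne_of_lt (lt_of_lt_of_le hj (Finset.mem_Ici.1 k.2)))
    exact (Submodule.mem_orthogonal_singleton_iff_inner_right).1 (this hxP')
  have h1 : a i * ‖x‖ ^ 2 ≤ (⟪x, T x⟫_ℂ).re := by
    rw [re_inner_apply_eq_sum u hT, ← u.sum_sq_norm_inner_right x, Finset.mul_sum]
    refine Finset.sum_le_sum fun j _ => ?_
    rcases le_or_gt j i with h | h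
    · exact mul_le_mul_of_nonneg_right (ha h) (by positivity)
    · simp [hz j h]
  have h2 : (⟪x, T' x⟫_ℂ).re ≤ a' i * ‖x‖ ^ 2 := by
    rw [re_inner_apply_eq_sum u' hT', ← u'.sum_sq_norm_inner_right x, Finset.mul_sum]
    refine Finset.sum_le_sum fun j _ => ?_
    rcases le_or_gt i j with h | h
    · exact mul_le_mul_of_nonneg_right (ha' h) (by positivity)
    · simp [hz' j h]
  have : 0 < ‖x‖ ^ 2 := by positivity
  exact le_of_mul_le_mul_right (h1.trans ((hle x).trans h2)) this

theorem eigenvalue_unique {T : E →ₗ[ℂ] E} (u u' : OrthonormalBasis (Fin d) ℂ E)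
    {a a' : Fin d → ℝ} (ha : Antitone a) (ha' : Antitone a')
    (hT : ∀ i, T (u i) = (a i : ℂ) • u i) (hT' : ∀ i, T (u' i) = (a' i : ℂ) • u' i) : a = a' :=
  funext fun i => le_antisymm (eigenvalue_mono u u' ha ha' hT hT' (fun _ => le_rfl) i)
    (eigenvalue_mono u' u ha' ha hT' hT (fun _ => le_rfl) i)

end Comparison

/-! Unitarily diagonalized matrices -/

section Matrices

variable {d : ℕ}

/-- The diagonal complex matrix with real entries `a`. -/
noncomputable def realDiagonal (a : Fin d → ℝ) : Matrix (Fin d) (Fin d) ℂ :=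
  diagonal fun i => (a i : ℂ)

/-- The unitary matrix `U` diagonalizes `N` with eigenvalues `a`. -/
structure Diagonalizes (U N : Matrix (Fin d) (Fin d) ℂ) (a : Fin d → ℝ) : Prop where
  unitary : Uᴴ * U = 1
  eq : N = U * realDiagonal a * Uᴴ

theorem realDiagonal_mul (a b : Fin d → ℝ) :
    realDiagonal a * realDiagonal b = realDiagonal fun i => a i * b i := by
  simp [realDiagonal]

theorem realDiagonal_add (a b : Fin d → ℝ) :
    realDiagonal a + realDiagonal b = realDiagonal fun i => a i + b i := by
  simp [realDiagonal]

theorem realDiagonal_conjTranspose (a : Fin d → ℝ) : (realDiagonal a)ᴴ = realDiagonal a := by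
  rw [realDiagonal, diagonal_conjTranspose]
  congr 1
  ext i
  simp

theorem realDiagonal_one : realDiagonal (fun _ : Fin d => (1 : ℝ)) = 1 := by
  simp [realDiagonal]

theorem realDiagonal_mul_inv {a : Fin d → ℝ} (ha : ∀ i, a i ≠ 0) :
    realDiagonal a * realDiagonal (fun i => (a i)⁻¹) = 1 := by
  rw [realDiagonal_mul]
  simp [ha, realDiagonal_one]

theorem trace_realDiagonal (a : Fin d → ℝ) : (realDiagonal a).trace = ((∑ i, a i : ℝ) : ℂ) := by
  simp [realDiagonal, trace]

namespace Diagonalizes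

variable {U N : Matrix (Fin d) (Fin d) ℂ} {a : Fin d → ℝ}

theorem unitary' (h : Diagonalizes U N a) : U * Uᴴ = 1 := mul_eq_one_comm.1 h.unitary

theorem isHermitian (h : Diagonalizes U N a) : N.IsHermitian := by
  rw [IsHermitian, h.eq]
  simp [realDiagonal_conjTranspose, mul_assoc]

theorem trace_eq (h : Diagonalizes U N a) : N.trace = ((∑ i, a i : ℝ) : ℂ) := by
  rw [h.eq, trace_mul_comm, ← mul_assoc, h.unitary, one_mul, trace_realDiagonal]

theorem det_eq (h : Diagonalizes U N a) : N.det = ((∏ i, a i : ℝ) : ℂ) := by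
  rw [h.eq, det_mul_comm, ← mul_assoc, h.unitary, one_mul, realDiagonal, det_diagonal]
  push_cast
  rfl

theorem mul_eq (h : Diagonalizes U N a) : N * U = U * realDiagonal a := by
  rw [h.eq, mul_assoc, h.unitary, mul_one]

theorem of_mul_eq (hU : Uᴴ * U = 1) (h : N * U = U * realDiagonal a) : Diagonalizes U N a :=
  ⟨hU, by rw [← h, mul_assoc, mul_eq_one_comm.1 hU, mul_one]⟩

theorem mul {N' : Matrix (Fin d) (Fin d) ℂ} {a' : Fin d → ℝ} (h : Diagonalizes U N a)
    (h' : Diagonalizes U N' a') : Diagonalizes U (N * N') fun i => a i * a' i :=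
  of_mul_eq h.unitary (by
    rw [mul_assoc, h'.mul_eq, ← mul_assoc, h.mul_eq, mul_assoc, realDiagonal_mul])

theorem add {N' : Matrix (Fin d) (Fin d) ℂ} {a' : Fin d → ℝ} (h : Diagonalizes U N a)
    (h' : Diagonalizes U N' a') : Diagonalizes U (N + N') fun i => a i + a' i :=
  of_mul_eq h.unitary (by
    rw [add_mul, h'.mul_eq, h.mul_eq, ← mul_add, realDiagonal_add])

theorem neg (h : Diagonalizes U N a) : Diagonalizes U (-N) fun i => -a i :=
  of_mul_eq h.unitary (by
    rw [neg_mul, h.mul_eq, ← mul_neg]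
    simp [realDiagonal])

theorem isUnit_det (h : Diagonalizes U N a) (ha : ∀ i, a i ≠ 0) : IsUnit N.det := by
  rw [h.det_eq, isUnit_iff_ne_zero]
  exact_mod_cast Finset.prod_ne_zero_iff.2 fun i _ => ha i

theorem inv (h : Diagonalizes U N a) (ha : ∀ i, a i ≠ 0) :
    Diagonalizes U N⁻¹ fun i => (a i)⁻¹ := by
  refine ⟨h.unitary, inv_eq_right_inv ?_⟩
  calc N * (U * realDiagonal (fun i => (a i)⁻¹) * Uᴴ)
      = (N * U) * realDiagonal (fun i => (a i)⁻¹) * Uᴴ := by simp only [mul_assoc]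
    _ = 1 := by rw [h.mul_eq, mul_assoc U, realDiagonal_mul_inv ha, mul_one, h.unitary']

theorem reindex (h : Diagonalizes U N a) (σ : Equiv.Perm (Fin d)) :
    Diagonalizes (U.submatrix id σ) N (a ∘ σ) := by
  refine of_mul_eq ?_ ?_
  · have h1 : (U.submatrix id σ)ᴴ * U.submatrix id σ = (Uᴴ * U).submatrix σ σ := by
      ext i j
      simp [mul_apply]
    rw [h1, h.unitary]
    simp
  · have h1 : N * U.submatrix id σ = (N * U).submatrix id σ := by
      ext i j
      simp [mul_apply]
    rw [h1, h.mul_eq]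
    ext i j
    simp [realDiagonal]

/-- The columns of `U` as an orthonormal basis. -/
noncomputable def basis (h : Diagonalizes U N a) :
    OrthonormalBasis (Fin d) ℂ (EuclideanSpace ℂ (Fin d)) :=
  (EuclideanSpace.basisFun (Fin d) ℂ).map
    (Unitary.linearIsometryEquiv
      ⟨toEuclideanCLM (n := Fin d) (𝕜 := ℂ) U, by
        rw [Unitary.mem_iff, ← map_star, ← map_mul, ← map_mul, star_eq_conjTranspose, h.unitary,
          h.unitary', map_one]
        exact ⟨rfl, rfl⟩⟩)

theorem basis_apply (h : Diagonalizes U N a) (i : Fin d) :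
    h.basis i = toEuclideanCLM (n := Fin d) (𝕜 := ℂ) U (EuclideanSpace.single i 1) := by
  simp only [basis, OrthonormalBasis.map_apply, EuclideanSpace.basisFun_apply]
  rfl

theorem toEuclideanCLM_basis (h : Diagonalizes U N a) (i : Fin d) :
    toEuclideanCLM (n := Fin d) (𝕜 := ℂ) N (h.basis i) = (a i : ℂ) • h.basis i := by
  rw [basis_apply, ← mul_apply_eq_comp, ← map_mul, h.mul_eq, map_mul,
    mul_apply_eq_comp, ← map_smul]
  congr 1
  ext j
  simp [realDiagonal, mulVec_diagonal, Pi.single_apply]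
  split_ifs with hij
  · rw [hij]
  · rfl

end Diagonalizes

/-- Bridge between the quadratic form of an operator, used for Weyl's principle, and the form by
which matrix positivity is expressed. -/
theorem inner_toEuclideanCLM_self (N : Matrix (Fin d) (Fin d) ℂ) (x : EuclideanSpace ℂ (Fin d)) :
    ⟪x, toEuclideanCLM (n := Fin d) (𝕜 := ℂ) N x⟫_ℂ = star x.ofLp ⬝ᵥ (N *ᵥ x.ofLp) := by
  rw [EuclideanSpace.inner_eq_star_dotProduct, dotProduct_comm]
  rfl

theorem Diagonalizes.mono {U N U' N' : Matrix (Fin d) (Fin d) ℂ} {a a' : Fin d → ℝ}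
    (h : Diagonalizes U N a) (h' : Diagonalizes U' N' a') (ha : Antitone a) (ha' : Antitone a')
    (hle : (N' - N).PosSemidef) (i : Fin d) : a i ≤ a' i := by
  refine eigenvalue_mono (T := toEuclideanCLM (n := Fin d) (𝕜 := ℂ) N)
    (T' := toEuclideanCLM (n := Fin d) (𝕜 := ℂ) N') h.basis h'.basis ha ha'
    h.toEuclideanCLM_basis h'.toEuclideanCLM_basis (fun x => ?_) i
  have := hle.re_dotProduct_nonneg x.ofLp
  rw [sub_mulVec, dotProduct_sub, map_sub, sub_nonneg] at this
  change (⟪x, toEuclideanCLM (n := Fin d) (𝕜 := ℂ) N x⟫_ℂ).re ≤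
    (⟪x, toEuclideanCLM (n := Fin d) (𝕜 := ℂ) N' x⟫_ℂ).re
  rw [inner_toEuclideanCLM_self, inner_toEuclideanCLM_self]
  exact this

theorem Diagonalizes.unique {U U' N : Matrix (Fin d) (Fin d) ℂ} {a a' : Fin d → ℝ}
    (h : Diagonalizes U N a) (h' : Diagonalizes U' N a') (ha : Antitone a) (ha' : Antitone a') :
    a = a' :=
  funext fun i => le_antisymm (h.mono h' ha ha' (by simpa using PosSemidef.zero) i)
    (h'.mono h ha' ha (by simpa using PosSemidef.zero) i)

theorem decreasingRearrangement_antitone (a : Fin d → ℝ) :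
    Antitone (decreasingRearrangement a) :=
  fun _ _ hij => Tuple.monotone_sort a (Fin.rev_le_rev.2 hij)

theorem decreasingRearrangement_eq_comp (a : Fin d → ℝ) :
    decreasingRearrangement a = a ∘ (Fin.revPerm.trans (Tuple.sort a)) := rfl

theorem Diagonalizes.sorted {U N : Matrix (Fin d) (Fin d) ℂ} {a : Fin d → ℝ}
    (h : Diagonalizes U N a) : ∃ U', Diagonalizes U' N (decreasingRearrangement a) :=
  ⟨_, h.reindex (Fin.revPerm.trans (Tuple.sort a))⟩

theorem exists_diagonalizes {N : Matrix (Fin d) (Fin d) ℂ} (hN : N.IsHermitian) :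
    ∃ U a, Diagonalizes U N a ∧ Antitone a := by
  have h : Diagonalizes (hN.eigenvectorUnitary : Matrix (Fin d) (Fin d) ℂ) N hN.eigenvalues := by
    refine ⟨?_, ?_⟩
    · rw [← star_eq_conjTranspose]
      exact Unitary.coe_star_mul_self _
    · conv_lhs => rw [hN.spectral_theorem]
      rfl
  obtain ⟨U', h'⟩ := h.sorted
  exact ⟨U', _, h', decreasingRearrangement_antitone _⟩

theorem posSemidef_realDiagonal {a : Fin d → ℝ} (ha : ∀ i, 0 ≤ a i) :
    (realDiagonal a).PosSemidef :=
  PosSemidef.diagonal fun i => by simpa using ha i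

theorem Diagonalizes.posSemidef {U N : Matrix (Fin d) (Fin d) ℂ} {a : Fin d → ℝ}
    (h : Diagonalizes U N a) (ha : ∀ i, 0 ≤ a i) : N.PosSemidef := by
  rw [h.eq]
  exact (posSemidef_realDiagonal ha).mul_mul_conjTranspose_same U

theorem Diagonalizes.pos {U N : Matrix (Fin d) (Fin d) ℂ} {a : Fin d → ℝ}
    (h : Diagonalizes U N a) (hN : N.PosDef) (i : Fin d) : 0 < a i := by
  have h1 := hN.re_dotProduct_pos (x := (h.basis i).ofLp) (by
    intro h0
    exact h.basis.orthonormal.ne_zero i (by ext j; exact congrFun h0 j))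
  rw [← inner_toEuclideanCLM_self, h.toEuclideanCLM_basis, inner_smul_right,
    inner_self_eq_norm_sq_to_K, h.basis.norm_eq_one] at h1
  simpa using h1

end Matrices

end ObliqueDuality

namespace ObliqueDuality

open scoped InnerProductSpace ComplexOrder
open Matrix

/-! ### Multiplicative Lidskii inequality and von Neumann's trace inequality -/

section Majorization

variable {d : ℕ}

/-- The multiplicative Lidskii inequality for the eigenvalues of a congruence `Mᴴ * X * M`. -/
theorem prod_eigenvalues_congruence_le {M X Ux Uy Ub : Matrix (Fin d) (Fin d) ℂ}
    {x y b : Fin d → ℝ} (hM : IsUnit M.det)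
    (hx : Diagonalizes Ux X x) (hy : Diagonalizes Uy (Mᴴ * X * M) y)
    (hb : Diagonalizes Ub (Mᴴ * M) b) (hxa : Antitone x) (hya : Antitone y) (hba : Antitone b)
    (hx0 : ∀ i, 0 < x i) (J : Finset (Fin d)) :
    ∏ j ∈ J, y j ≤ (∏ j ∈ J, b j) * ∏ j : Fin d with j.val < J.card, x j := by
  rcases J.eq_empty_or_nonempty with rfl | hJ
  · simp
  have hJd : J.card ≤ d := by simpa using J.card_le_univ
  have hJ1 : 0 < J.card := hJ.card_pos
  obtain ⟨k, hk⟩ : ∃ k : Fin d, k.val = J.card - 1 := ⟨⟨J.card - 1, by omega⟩, rfl⟩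
  -- Truncation level: `k` is the last of the first `J.card` indices (counted from `0`). Raising
  -- every eigenvalue of `X` below `t` up to `t` changes none of the first `J.card` of them.
  set t := x k with ht
  have ht0 : 0 < t := hx0 k
  have hMinj : Function.Injective M.mulVec :=
    mulVec_injective_iff_isUnit.2 ((isUnit_iff_isUnit_det M).2 hM)
  have hb0 : ∀ i, 0 < b i := hb.pos (PosDef.conjTranspose_mul_self M hMinj)
  have hy0 : ∀ i, 0 ≤ y i := by
    intro i
    have h0 : Diagonalizes 1 (0 : Matrix (Fin d) (Fin d) ℂ) (fun _ => 0) :=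
      ⟨by simp, by simp [realDiagonal]⟩
    refine h0.mono hy antitone_const hya ?_ i
    rw [sub_zero]
    exact (hx.posSemidef fun i => (hx0 i).le).conjTranspose_mul_mul_same M
  let x' : Fin d → ℝ := fun i => max (x i) t
  have hx' : Diagonalizes Ux (Ux * realDiagonal x' * Uxᴴ) x' := ⟨hx.unitary, rfl⟩
  set X' := Ux * realDiagonal x' * Uxᴴ
  have hY'h : (Mᴴ * X' * M).IsHermitian := isHermitian_conjTranspose_mul_mul M hx'.isHermitian
  obtain ⟨Uy', y', hy', hy'a⟩ := exists_diagonalizes hY'h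
  have hyy' : ∀ i, y i ≤ y' i := by
    refine hy.mono hy' hya hy'a ?_
    have h1 : Diagonalizes Ux (X' + -X) fun i => x' i + -x i := hx'.add hx.neg
    have h2 := (h1.posSemidef fun i => by
      have := le_max_left (x i) t
      simp only [x']
      linarith).conjTranspose_mul_mul_same M
    rw [← sub_eq_add_neg, Matrix.mul_sub, Matrix.sub_mul] at h2
    exact h2
  have htb : Diagonalizes Ub ((t : ℂ) • (Mᴴ * M)) fun i => t * b i := by
    refine Diagonalizes.of_mul_eq hb.unitary ?_
    rw [smul_mul_assoc, hb.mul_eq, ← mul_smul_comm]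
    congr 1
    ext i j
    by_cases h : i = j <;> simp [realDiagonal, h]
  -- The truncated matrix dominates both `X` and `t • 1`. The first comparison controls the factors
  -- in `J`, the second those outside it.
  have hby' : ∀ i, t * b i ≤ y' i := by
    refine htb.mono hy' (fun i j hij => mul_le_mul_of_nonneg_left (hba hij) ht0.le) hy'a ?_
    have h1 : Diagonalizes Ux ((t : ℂ) • (1 : Matrix (Fin d) (Fin d) ℂ)) fun _ => t := by
      refine Diagonalizes.of_mul_eq hx.unitary ?_
      rw [smul_mul_assoc, one_mul]
      ext i j
      simp [realDiagonal, mul_comm]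
    have h2 := ((hx'.add h1.neg).posSemidef fun i => by
      have := le_max_right (x i) t
      simp only [x']
      linarith).conjTranspose_mul_mul_same M
    rw [← sub_eq_add_neg, Matrix.mul_sub, Matrix.sub_mul, mul_smul_comm, smul_mul_assoc,
      mul_one] at h2
    exact h2
  -- The full product is known exactly through the determinant; bounding the factors outside `J`
  -- from below therefore bounds those inside `J` from above.
  have hdet : ∏ i, y' i = (∏ i, b i) * ∏ i, x' i := by
    have h1 := hy'.det_eq
    rw [det_mul, det_mul, mul_right_comm, ← det_mul, hb.det_eq, hx'.det_eq] at h1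
    exact_mod_cast h1.symm
  have hxk : ∀ i : Fin d, i.val < J.card → x' i = x i := fun i hi =>
    max_eq_left (hxa (Fin.le_def.2 (by omega)))
  have hxk' : ∀ i : Fin d, ¬ i.val < J.card → x' i = t := fun i hi =>
    max_eq_right (hxa (Fin.le_def.2 (by omega)))
  have hcard : (Finset.univ.filter fun i : Fin d => ¬ i.val < J.card).card = Jᶜ.card := by
    rw [Finset.filter_not, Finset.card_sdiff_of_subset (Finset.filter_subset _ _),
      Finset.card_compl, Fin.card_filter_val_lt, min_eq_right hJd]
    simp
  have hprodx : ∏ i, x' i = (∏ j : Fin d with j.val < J.card, x j) * t ^ Jᶜ.card := by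
    rw [← Finset.prod_filter_mul_prod_filter_not Finset.univ (fun i : Fin d => i.val < J.card)]
    congr 1
    · exact Finset.prod_congr rfl fun i hi => hxk i (Finset.mem_filter.1 hi).2
    · rw [Finset.prod_congr rfl fun i hi => hxk' i (Finset.mem_filter.1 hi).2,
        Finset.prod_const, hcard]
  have hpos : 0 < ∏ j ∈ Jᶜ, t * b j := Finset.prod_pos fun i _ => mul_pos ht0 (hb0 i)
  refine le_of_mul_le_mul_right ?_ hpos
  calc (∏ j ∈ J, y j) * ∏ j ∈ Jᶜ, t * b j
      ≤ (∏ j ∈ J, y' j) * ∏ j ∈ Jᶜ, y' j := by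
        refine mul_le_mul (Finset.prod_le_prod (fun i _ => hy0 i) fun i _ => hyy' i)
          (Finset.prod_le_prod (fun i _ => (mul_pos ht0 (hb0 i)).le) fun i _ => hby' i)
          hpos.le (Finset.prod_nonneg fun i _ => (hy0 i).trans (hyy' i))
    _ = ((∏ j ∈ J, b j) * ∏ j ∈ Jᶜ, b j) *
        ((∏ j : Fin d with j.val < J.card, x j) * t ^ Jᶜ.card) := by
        rw [Finset.prod_mul_prod_compl, Finset.prod_mul_prod_compl, hdet, hprodx]
    _ = (∏ j ∈ J, b j) * (∏ j : Fin d with j.val < J.card, x j) * ∏ j ∈ Jᶜ, t * b j := by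
        rw [Finset.prod_mul_distrib, Finset.prod_const]
        ring

/-- By Birkhoff's theorem `D` is a convex combination of permutation matrices, and for each of these
the bound is the rearrangement inequality. -/
theorem sum_doublyStochastic_le {D : Matrix (Fin d) (Fin d) ℝ} (hD : D ∈ doublyStochastic ℝ (Fin d))
    {a c : Fin d → ℝ} (ha : Antitone a) (hc : Antitone c) :
    ∑ i, ∑ j, a i * c j * D i j ≤ ∑ i, a i * c i := by
  obtain ⟨w, hw0, hw1, hw⟩ := exists_eq_sum_perm_of_mem_doublyStochastic hD
  have h1 : ∀ σ : Equiv.Perm (Fin d),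
      ∑ i, ∑ j, a i * c j * (σ.permMatrix ℝ) i j = ∑ i, a i * c (σ i) := by
    intro σ
    refine Finset.sum_congr rfl fun i _ => ?_
    rw [Finset.sum_eq_single (σ i)]
    · simp [Equiv.Perm.permMatrix, PEquiv.toMatrix_apply]
    · intro j _ hj
      simp [Equiv.Perm.permMatrix, PEquiv.toMatrix_apply, hj.symm]
    · simp
  calc ∑ i, ∑ j, a i * c j * D i j
      = ∑ σ, w σ * ∑ i, ∑ j, a i * c j * (σ.permMatrix ℝ) i j := by
        rw [← hw]
        simp only [Matrix.sum_apply, Matrix.smul_apply, smul_eq_mul, Finset.mul_sum]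
        symm
        rw [Finset.sum_comm]
        refine Finset.sum_congr rfl fun i _ => ?_
        rw [Finset.sum_comm]
        exact Finset.sum_congr rfl fun j _ => Finset.sum_congr rfl fun σ _ => by ring
    _ ≤ ∑ σ, w σ * ∑ i, a i * c i := by
        refine Finset.sum_le_sum fun σ _ => mul_le_mul_of_nonneg_left ?_ (hw0 σ)
        rw [h1]
        exact (ha.monovary hc).sum_mul_comp_perm_le_sum_mul
    _ = ∑ i, a i * c i := by rw [← Finset.sum_mul, hw1, one_mul]

/-- Rows and columns of a unitary matrix are unit vectors. -/
theorem normSq_mem_doublyStochastic {K : Matrix (Fin d) (Fin d) ℂ} (hK : Kᴴ * K = 1) :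
    (of fun i j => Complex.normSq (K i j)) ∈ doublyStochastic ℝ (Fin d) := by
  rw [mem_doublyStochastic_iff_sum]
  refine ⟨fun i j => Complex.normSq_nonneg _, fun i => ?_, fun j => ?_⟩
  · have h := congrFun (congrFun (show K * Kᴴ = 1 from mul_eq_one_comm.1 hK) i) i
    simp only [mul_apply, conjTranspose_apply, one_apply_eq, RCLike.star_def,
      Complex.mul_conj] at h
    exact_mod_cast h
  · have h := congrFun (congrFun hK j) j
    simp only [mul_apply, conjTranspose_apply, one_apply_eq, RCLike.star_def,
      ← Complex.normSq_eq_conj_mul_self] at h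
    exact_mod_cast h

/-- Von Neumann's trace inequality. -/
theorem re_trace_mul_le {A C U V : Matrix (Fin d) (Fin d) ℂ} {a c : Fin d → ℝ}
    (hA : Diagonalizes U A a) (hC : Diagonalizes V C c) (ha : Antitone a) (hc : Antitone c) :
    (A * C).trace.re ≤ ∑ i, a i * c i := by
  -- The squared moduli of the change of eigenbasis `Uᴴ * V` are the weights in the expansion of the
  -- trace as a double sum of products `a i * c j`.
  have hK : (Uᴴ * V)ᴴ * (Uᴴ * V) = 1 := by
    rw [conjTranspose_mul, conjTranspose_conjTranspose, mul_assoc, ← mul_assoc U, hA.unitary',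
      one_mul, hC.unitary]
  refine le_of_eq_of_le ?_ (sum_doublyStochastic_le (normSq_mem_doublyStochastic hK) ha hc)
  have h1 : (A * C).trace = (realDiagonal a * (Uᴴ * V) * (realDiagonal c * (Uᴴ * V)ᴴ)).trace := by
    rw [hA.eq, hC.eq, mul_assoc, mul_assoc, trace_mul_comm, conjTranspose_mul,
      conjTranspose_conjTranspose]
    simp only [mul_assoc]
  rw [h1, trace, Complex.re_sum]
  refine Finset.sum_congr rfl fun i _ => ?_
  rw [diag_apply, mul_apply, Complex.re_sum]
  refine Finset.sum_congr rfl fun j _ => ?_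
  rw [realDiagonal, realDiagonal, diagonal_mul, diagonal_mul, conjTranspose_apply,
    RCLike.star_def, mul_mul_mul_comm, Complex.mul_conj]
  simp [← Complex.ofReal_mul]

/-- In the equality case of the trace inequality, the two matrices are simultaneously
diagonalizable with both eigenvalue lists in non-increasing order. -/
theorem exists_diagonalizes_of_trace_eq {A C U V : Matrix (Fin d) (Fin d) ℂ} {a c : Fin d → ℝ}
    (hA : Diagonalizes U A a) (hC : Diagonalizes V C c) (ha : Antitone a) (hc : Antitone c)
    (htr : (A * C).trace.re = ∑ i, a i * c i) :
    ∃ Z, Diagonalizes Z A a ∧ Diagonalizes Z C c := by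
  -- The common eigenbasis will be one of the sum `A + C`: the argument shows that its ordered
  -- eigenvalues are `a + c`, and that its eigenvectors diagonalize each summand.
  obtain ⟨Z, e, hE, hea⟩ := exists_diagonalizes (hA.isHermitian.add hC.isHermitian)
  have hAA : (A * A).trace.re = ∑ i, a i * a i := by rw [(hA.mul hA).trace_eq, Complex.ofReal_re]
  have hCC : (C * C).trace.re = ∑ i, c i * c i := by rw [(hC.mul hC).trace_eq, Complex.ofReal_re]
  have hEE : ((A + C) * (A + C)).trace.re = ∑ i, e i * e i := by
    rw [(hE.mul hE).trace_eq, Complex.ofReal_re]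
  have hEA := re_trace_mul_le hE hA hea ha
  have hEC := re_trace_mul_le hE hC hea hc
  have hCA : (C * A).trace = (A * C).trace := trace_mul_comm _ _
  simp only [add_mul, mul_add, trace_add, Complex.add_re, hCA] at hEE hEA hEC
  have he : ∀ i, e i = a i + c i := by
    have h1 : ∑ i, (e i - (a i + c i)) ^ 2 = (∑ i, e i * e i) - 2 * (∑ i, e i * a i)
        - 2 * (∑ i, e i * c i) + (∑ i, a i * a i) + 2 * (∑ i, a i * c i) + ∑ i, c i * c i := by
      simp only [Finset.mul_sum, ← Finset.sum_add_distrib, ← Finset.sum_sub_distrib]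
      exact Finset.sum_congr rfl fun i _ => by ring
    -- The equality hypothesis makes `∑ (a i + c i) ^ 2` equal to the trace of `(A + C) ^ 2`, that
    -- is, `∑ e i ^ 2`. The trace inequality for `A + C` against `A` and against `C` bounds this
    -- same quantity by `∑ e i * (a i + c i)`.
    have h2 : ∑ i, (e i - (a i + c i)) ^ 2 ≤ 0 := by linarith
    intro i
    have h3 := (Finset.sum_eq_zero_iff_of_nonneg fun i _ => sq_nonneg _).1
      (le_antisymm h2 (Finset.sum_nonneg fun i _ => sq_nonneg _)) i (Finset.mem_univ i)
    linarith [pow_eq_zero_iff (two_ne_zero) |>.1 h3]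
  have hZa : Diagonalizes Z (Z * realDiagonal a * Zᴴ) a := ⟨hE.unitary, rfl⟩
  have hZc : Diagonalizes Z (Z * realDiagonal c * Zᴴ) c := ⟨hE.unitary, rfl⟩
  set A' := Z * realDiagonal a * Zᴴ
  set C' := Z * realDiagonal c * Zᴴ
  have hsum : A + C = A' + C' := by
    rw [hE.eq, (hZa.add hZc).eq]
    congr 3
    exact funext he
  have hAC' := re_trace_mul_le hA hZc ha hc
  have hAA'ge : ∑ i, a i * a i ≤ (A * A').trace.re := by
    have h1 : (A * A').trace.re + (A * C').trace.re = (A * A).trace.re + (A * C).trace.re := by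
      rw [← Complex.add_re, ← Complex.add_re, ← trace_add, ← trace_add, ← mul_add, ← mul_add, hsum]
    linarith
  have hA'A' : (A' * A').trace.re = ∑ i, a i * a i := by
    rw [(hZa.mul hZa).trace_eq, Complex.ofReal_re]
  -- The squared Frobenius norm of `A - A'` is `2 ∑ a i ^ 2` minus twice the trace of `A * A'`,
  -- hence at most zero by `hAA'ge`.
  have hAA' : A = A' := by
    have hps := posSemidef_conjTranspose_mul_self (A - A')
    have hle : ((A - A')ᴴ * (A - A')).trace.re ≤ 0 := by
      rw [conjTranspose_sub, hA.isHermitian.eq, hZa.isHermitian.eq]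
      simp only [sub_mul, mul_sub, trace_sub, Complex.sub_re, trace_mul_comm A' A]
      linarith
    have h0 : ((A - A')ᴴ * (A - A')).trace = 0 := by
      have h1 := Complex.nonneg_iff.1 hps.trace_nonneg
      exact Complex.ext (le_antisymm hle h1.1) h1.2.symm
    exact sub_eq_zero.1 (trace_conjTranspose_mul_self_eq_zero_iff.1 h0)
  have hCC' : C = C' := by
    rw [← hAA'] at hsum
    exact add_left_cancel hsum
  exact ⟨Z, hAA' ▸ hZa, hCC' ▸ hZc⟩

end Majorization

end ObliqueDuality

namespace ObliqueDuality

open scoped InnerProductSpace ComplexOrder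
open Matrix

/-! ### Spectrum of the matrix of the dual frame -/

section Congruence

variable {d : ℕ}

theorem exists_diagonalizes_of_posDef {N : Matrix (Fin d) (Fin d) ℂ} (hN : N.PosDef) :
    ∃ U a, Diagonalizes U N a ∧ Antitone a ∧ ∀ i, 0 < a i :=
  let ⟨U, a, h, ha⟩ := exists_diagonalizes hN.isHermitian
  ⟨U, a, h, ha, h.pos hN⟩

/-- The columns of `B` are orthogonal with squared lengths `t i`; normalizing them gives the unitary
matrix, and the lengths are absorbed into the eigenvalues. -/
theorem diagonalizes_of_conjTranspose_mul_self {B : Matrix (Fin d) (Fin d) ℂ} {t : Fin d → ℝ}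
    (hB : Bᴴ * B = realDiagonal t) (ht : ∀ i, 0 < t i) (r : Fin d → ℝ) :
    ∃ U, Diagonalizes U (B * realDiagonal r * Bᴴ) fun i => t i * r i := by
  have ht' : ∀ i, √(t i) ≠ 0 := fun i => (Real.sqrt_pos.2 (ht i)).ne'
  refine ⟨B * realDiagonal fun i => (√(t i))⁻¹, ?_, ?_⟩
  · rw [conjTranspose_mul, realDiagonal_conjTranspose, mul_assoc, ← mul_assoc Bᴴ, hB,
      realDiagonal_mul, realDiagonal_mul, ← realDiagonal_one]
    congr 1
    ext i
    rw [← mul_assoc, mul_comm, ← mul_assoc, ← mul_inv, Real.mul_self_sqrt (ht i).le,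
      inv_mul_cancel₀ (ht i).ne']
  · rw [conjTranspose_mul, realDiagonal_conjTranspose]
    simp only [mul_assoc]
    congr 1
    simp only [← mul_assoc, realDiagonal_mul]
    congr 2
    ext i
    have := ht' i
    have h2 := Real.mul_self_sqrt (ht i).le
    field_simp
    rw [sq, h2]

/-- `Gᴴ` maps an eigenbasis of `G * Gᴴ` to orthogonal eigenvectors of `Gᴴ * G`. This lets the angles
be read off on `V` or on `W`. -/
theorem exists_diagonalizes_conjTranspose_mul_self {G U : Matrix (Fin d) (Fin d) ℂ}
    {q : Fin d → ℝ} (hq : Diagonalizes U (G * Gᴴ) q) (hq0 : ∀ i, 0 < q i) :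
    ∃ U', Diagonalizes U' (Gᴴ * G) q := by
  have hB : (Gᴴ * U)ᴴ * (Gᴴ * U) = realDiagonal q := by
    rw [conjTranspose_mul, conjTranspose_conjTranspose, mul_assoc, ← mul_assoc G, hq.mul_eq,
      ← mul_assoc, hq.unitary, one_mul]
  obtain ⟨U', h⟩ := diagonalizes_of_conjTranspose_mul_self hB hq0 fun _ => 1
  refine ⟨U', ?_⟩
  simpa [realDiagonal_one, conjTranspose_mul, mul_assoc, ← mul_assoc U, hq.unitary'] using h

theorem Diagonalizes.inv_rev {U N : Matrix (Fin d) (Fin d) ℂ} {a : Fin d → ℝ}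
    (h : Diagonalizes U N a) (ha : ∀ i, 0 < a i) :
    ∃ U', Diagonalizes U' N⁻¹ fun i => (a i.rev)⁻¹ :=
  ⟨_, (h.inv fun i => (ha i).ne').reindex Fin.revPerm⟩

theorem antitone_inv_rev {a : Fin d → ℝ} (ha : Antitone a) (ha0 : ∀ i, 0 < a i) :
    Antitone fun i : Fin d => (a i.rev)⁻¹ :=
  fun _ _ hij => inv_anti₀ (ha0 _) (ha (Fin.rev_le_rev.2 hij))

theorem Diagonalizes.of_inv {U N : Matrix (Fin d) (Fin d) ℂ} {a : Fin d → ℝ}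
    (hN : IsUnit N.det) (h : Diagonalizes U N⁻¹ fun i => (a i)⁻¹) (ha : ∀ i, 0 < a i) :
    Diagonalizes U N a := by
  have h1 := h.inv fun i => inv_ne_zero (ha i).ne'
  rw [nonsing_inv_nonsing_inv _ hN] at h1
  simpa using h1

variable {s G Us Uq Up : Matrix (Fin d) (Fin d) ℂ} {l q p : Fin d → ℝ}

/-- Lidskii for the congruence of `s⁻¹` by `M = (G⁻¹)ᴴ`, where `Mᴴ * M` is the inverse of `Gᴴ * G`,
and with the first `k` indices as index set. -/
theorem prod_eigenvalues_dual_le (hG : IsUnit G.det) (hs : Diagonalizes Us s l)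
    (hq : Diagonalizes Uq (G * Gᴴ) q) (hp : Diagonalizes Up (G⁻¹ * s⁻¹ * (G⁻¹)ᴴ) p)
    (hla : Antitone l) (hqa : Antitone q) (hpa : Antitone p)
    (hl0 : ∀ i, 0 < l i) (hq0 : ∀ i, 0 < q i) {k : ℕ} (hk : k ≤ d) :
    ∏ j : Fin d with j.val < k, p j ≤ (∏ j : Fin d with j.val < k, l j.rev * q j.rev)⁻¹ := by
  obtain ⟨U', hq'⟩ := exists_diagonalizes_conjTranspose_mul_self hq hq0
  obtain ⟨U1, hs1⟩ := hs.inv_rev hl0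
  obtain ⟨U2, hq2⟩ := hq'.inv_rev hq0
  have h1 : (Gᴴ * G)⁻¹ = (G⁻¹)ᴴᴴ * (G⁻¹)ᴴ := by
    rw [Matrix.mul_inv_rev, conjTranspose_conjTranspose, conjTranspose_nonsing_inv]
  have hM : IsUnit (G⁻¹)ᴴ.det := by
    rw [det_conjTranspose]
    exact (isUnit_nonsing_inv_det G hG).star
  rw [h1] at hq2
  have hp' : Diagonalizes Up ((G⁻¹)ᴴᴴ * s⁻¹ * (G⁻¹)ᴴ) p := by
    rwa [conjTranspose_conjTranspose]
  have h2 := prod_eigenvalues_congruence_le hM hs1 hp' hq2 (antitone_inv_rev hla hl0) hpa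
    (antitone_inv_rev hqa hq0) (fun i => inv_pos.2 (hl0 _)) (Finset.univ.filter fun j => j.val < k)
  rw [Fin.card_filter_val_lt, min_eq_right hk, ← Finset.prod_mul_distrib] at h2
  rw [← Finset.prod_inv_distrib]
  simpa [mul_comm] using h2

/-- Lidskii for the reverse congruence by `Gᴴ`, which takes the dual matrix back to `s⁻¹`. The index
set stays arbitrary because the products on the left need not be in decreasing order. -/
theorem le_prod_eigenvalues_dual (hG : IsUnit G.det) (hs : Diagonalizes Us s l)
    (hq : Diagonalizes Uq (G * Gᴴ) q) (hp : Diagonalizes Up (G⁻¹ * s⁻¹ * (G⁻¹)ᴴ) p)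
    (hla : Antitone l) (hqa : Antitone q) (hpa : Antitone p)
    (hl0 : ∀ i, 0 < l i) (hq0 : ∀ i, 0 < q i) (hp0 : ∀ i, 0 < p i) (J : Finset (Fin d)) :
    ∏ j ∈ J, (l j.rev)⁻¹ * (q j)⁻¹ ≤ ∏ j : Fin d with j.val < J.card, p j := by
  obtain ⟨U1, hs1⟩ := hs.inv_rev hl0
  have hM : IsUnit (Gᴴ).det := by
    rw [det_conjTranspose]
    exact hG.star
  have h1 : s⁻¹ = Gᴴᴴ * (G⁻¹ * s⁻¹ * (G⁻¹)ᴴ) * Gᴴ := by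
    rw [conjTranspose_conjTranspose, mul_assoc G⁻¹, mul_nonsing_inv_cancel_left _ _ hG, mul_assoc,
      ← conjTranspose_mul, mul_nonsing_inv _ hG, conjTranspose_one, mul_one]
  rw [h1] at hs1
  have hq' : Diagonalizes Uq (Gᴴᴴ * Gᴴ) q := by rwa [conjTranspose_conjTranspose]
  have h2 := prod_eigenvalues_congruence_le hM hp hs1 hq' hpa (antitone_inv_rev hla hl0) hqa hp0 J
  rw [Finset.prod_mul_distrib, Finset.prod_inv_distrib (fun j => q j), ← div_eq_mul_inv,
    div_le_iff₀ (Finset.prod_pos fun i _ => hq0 i), mul_comm]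
  exact h2

/-- `G⁻¹` keeps a common eigenbasis orthogonal, with squared lengths the inverses of `q`, and the
dual matrix is diagonal along the image. -/
theorem exists_diagonalizes_dual {Z : Matrix (Fin d) (Fin d) ℂ}
    (hs : Diagonalizes Z s l) (hq : Diagonalizes Z (G * Gᴴ) q)
    (hl0 : ∀ i, 0 < l i) (hq0 : ∀ i, 0 < q i) :
    ∃ U, Diagonalizes U (G⁻¹ * s⁻¹ * (G⁻¹)ᴴ) fun i => (l i)⁻¹ * (q i)⁻¹ := by
  have hqi := hq.inv fun i => (hq0 i).ne'
  have hB : (G⁻¹ * Z)ᴴ * (G⁻¹ * Z) = realDiagonal fun i => (q i)⁻¹ := by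
    have h1 : (G * Gᴴ)⁻¹ = (G⁻¹)ᴴ * G⁻¹ := by rw [Matrix.mul_inv_rev, conjTranspose_nonsing_inv]
    rw [conjTranspose_mul, mul_assoc, ← mul_assoc _ _ Z, ← h1, hqi.mul_eq, ← mul_assoc,
      hq.unitary, one_mul]
  obtain ⟨U, hU⟩ := diagonalizes_of_conjTranspose_mul_self hB (fun i => inv_pos.2 (hq0 i))
    fun i => (l i)⁻¹
  refine ⟨U, ?_⟩
  have h2 := (hs.inv fun i => (hl0 i).ne').eq
  convert hU using 1
  · rw [h2, conjTranspose_mul]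
    simp only [mul_assoc]
  · ext i
    rw [mul_comm]

theorem posDef_mul_conjTranspose (hG : IsUnit G.det) : (G * Gᴴ).PosDef :=
  PosDef.mul_conjTranspose_self G
    (vecMul_injective_iff_isUnit.2 ((isUnit_iff_isUnit_det G).2 hG))

theorem posDef_dual (hG : IsUnit G.det) (hs : s.PosDef) : (G⁻¹ * s⁻¹ * (G⁻¹)ᴴ).PosDef :=
  hs.inv.mul_mul_conjTranspose_same (vecMul_injective_iff_isUnit.2
    ((isUnit_iff_isUnit_det _).2 (isUnit_nonsing_inv_det G hG)))

theorem trace_dual (G s : Matrix (Fin d) (Fin d) ℂ) :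
    (G⁻¹ * s⁻¹ * (G⁻¹)ᴴ).trace = (s⁻¹ * (G * Gᴴ)⁻¹).trace := by
  rw [mul_assoc, trace_mul_comm, Matrix.mul_inv_rev, conjTranspose_nonsing_inv, mul_assoc]

/-- The list on the left gives the trace of `s⁻¹ * (G * Gᴴ)⁻¹` its maximal value, so the equality
case of the trace inequality applies to these two inverses. -/
theorem eq_prod_sorted_iff (hs : Diagonalizes Us s l)
    (hq : Diagonalizes Uq (G * Gᴴ) q) (hp : Diagonalizes Up (G⁻¹ * s⁻¹ * (G⁻¹)ᴴ) p)
    (hla : Antitone l) (hqa : Antitone q) (hpa : Antitone p)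
    (hl0 : ∀ i, 0 < l i) (hq0 : ∀ i, 0 < q i) :
    (p = fun j => (l j.rev)⁻¹ * (q j.rev)⁻¹) ↔
      ∃ Z, Diagonalizes Z s l ∧ Diagonalizes Z (G * Gᴴ) q := by
  constructor
  · intro h
    obtain ⟨U1, hs1⟩ := hs.inv_rev hl0
    obtain ⟨U2, hq1⟩ := hq.inv_rev hq0
    obtain ⟨Z, hZ1, hZ2⟩ := exists_diagonalizes_of_trace_eq hs1 hq1 (antitone_inv_rev hla hl0)
      (antitone_inv_rev hqa hq0) (by rw [← trace_dual, hp.trace_eq, Complex.ofReal_re, h])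
    have h1 := (hZ1.reindex Fin.revPerm)
    have h2 := (hZ2.reindex Fin.revPerm)
    refine ⟨Z.submatrix id Fin.revPerm, .of_inv (hs.isUnit_det fun i => (hl0 i).ne') ?_ hl0,
      .of_inv (hq.isUnit_det fun i => (hq0 i).ne') ?_ hq0⟩
    · convert h1 using 2 with i
      simp
    · convert h2 using 2 with i
      simp
  · rintro ⟨Z, hZ1, hZ2⟩
    obtain ⟨U, hU⟩ := exists_diagonalizes_dual hZ1 hZ2 hl0 hq0
    refine hp.unique (hU.reindex Fin.revPerm) hpa fun i j hij => ?_
    exact mul_le_mul (antitone_inv_rev hla hl0 hij) (antitone_inv_rev hqa hq0 hij)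
      (inv_pos.2 (hq0 _)).le (inv_pos.2 (hl0 _)).le

/-- The list on the left gives the minimal trace: opposite orderings are paired. Only the sum of the
list matters for the forward direction, so the rearrangement is harmless there. -/
theorem eq_decreasingRearrangement_iff (hs : Diagonalizes Us s l)
    (hq : Diagonalizes Uq (G * Gᴴ) q) (hp : Diagonalizes Up (G⁻¹ * s⁻¹ * (G⁻¹)ᴴ) p)
    (hla : Antitone l) (hqa : Antitone q) (hpa : Antitone p)
    (hl0 : ∀ i, 0 < l i) (hq0 : ∀ i, 0 < q i) :
    (p = decreasingRearrangement fun j => (l j.rev)⁻¹ * (q j)⁻¹) ↔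
      ∃ Z, Diagonalizes Z s (fun j => l j.rev) ∧ Diagonalizes Z (G * Gᴴ) q := by
  constructor
  · intro h
    obtain ⟨U1, hs1⟩ := hs.inv_rev hl0
    -- Negating the second inverse turns the minimum into a maximum, and its eigenvalues `-(q i)⁻¹`
    -- are non-increasing without reversing indices.
    have hq1 := (hq.inv fun i => (hq0 i).ne').neg
    obtain ⟨Z, hZ1, hZ2⟩ := exists_diagonalizes_of_trace_eq hs1 hq1 (antitone_inv_rev hla hl0)
      (fun i j hij => neg_le_neg (inv_anti₀ (hq0 _) (hqa hij))) (by
        rw [mul_neg, trace_neg, ← trace_dual, hp.trace_eq, Complex.neg_re, Complex.ofReal_re, h,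
          decreasingRearrangement_eq_comp]
        simp only [Function.comp_apply]
        rw [Equiv.sum_comp (Fin.revPerm.trans (Tuple.sort fun j : Fin d => (l j.rev)⁻¹ * (q j)⁻¹))
          (fun j => (l j.rev)⁻¹ * (q j)⁻¹), ← Finset.sum_neg_distrib]
        simp only [mul_neg])
    have h2 := hZ2.neg
    simp only [neg_neg] at h2
    exact ⟨Z, .of_inv (hs.isUnit_det fun i => (hl0 i).ne') hZ1 fun i => hl0 _,
      .of_inv (hq.isUnit_det fun i => (hq0 i).ne') h2 hq0⟩
  · rintro ⟨Z, hZ1, hZ2⟩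
    obtain ⟨U, hU⟩ := exists_diagonalizes_dual hZ1 hZ2 (fun i => hl0 _) hq0
    obtain ⟨U', hU'⟩ := hU.sorted
    exact hp.unique hU' hpa (decreasingRearrangement_antitone _)

end Congruence

end ObliqueDuality

namespace ObliqueDuality

open scoped InnerProductSpace ComplexOrder
open Matrix

/-! Synthesis operators -/

section Synthesis

variable {H : Type*} [NormedAddCommGroup H] [InnerProductSpace ℂ H] {d : ℕ} {W : Submodule ℂ H}

theorem synthesis_apply {n : ℕ} (f : Fin n → H) (x : EuclideanSpace ℂ (Fin n)) :
    synthesis f x = ∑ i, x i • f i := by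
  simp [synthesis]

theorem synthesis_single {n : ℕ} (f : Fin n → H) (i : Fin n) :
    synthesis f (EuclideanSpace.single i 1) = f i := by
  simp [synthesis_apply]

theorem orthonormal_coe (b : OrthonormalBasis (Fin d) ℂ W) : Orthonormal ℂ fun i => (b i : H) :=
  b.orthonormal.comp_linearIsometry W.subtypeₗᵢ

theorem synthesis_coe_basis (b : OrthonormalBasis (Fin d) ℂ W) (x : EuclideanSpace ℂ (Fin d)) :
    synthesis (fun i => (b i : H)) x = b.repr.symm x := by
  rw [synthesis_apply, ← b.sum_repr_symm]
  simp

end Synthesis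

/-! Operators on a subspace given by matrices -/

section Transport

variable {H : Type*} [NormedAddCommGroup H] [InnerProductSpace ℂ H] [CompleteSpace H] {d : ℕ}

/-- The operator on `H` obtained from the matrix `N` through the map `J`. -/
noncomputable def transport (J : EuclideanSpace ℂ (Fin d) →L[ℂ] H)
    (N : Matrix (Fin d) (Fin d) ℂ) : H →L[ℂ] H :=
  J ∘L toEuclideanCLM (n := Fin d) (𝕜 := ℂ) N ∘L J.adjoint

variable {J : EuclideanSpace ℂ (Fin d) →L[ℂ] H}

theorem adjoint_apply_apply (hJ : J.adjoint ∘L J = 1) (x : EuclideanSpace ℂ (Fin d)) :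
    J.adjoint (J x) = x := by
  simpa using congrArg (fun T : _ →L[ℂ] _ => T x) hJ

theorem transport_apply (J : EuclideanSpace ℂ (Fin d) →L[ℂ] H)
    (N : Matrix (Fin d) (Fin d) ℂ) (x : H) :
    transport J N x = J (toEuclideanCLM (n := Fin d) (𝕜 := ℂ) N (J.adjoint x)) := rfl

theorem toEuclideanCLM_mul_apply (N N' : Matrix (Fin d) (Fin d) ℂ)
    (x : EuclideanSpace ℂ (Fin d)) :
    toEuclideanCLM (n := Fin d) (𝕜 := ℂ) (N * N') x =
      toEuclideanCLM (n := Fin d) (𝕜 := ℂ) N (toEuclideanCLM (n := Fin d) (𝕜 := ℂ) N' x) := by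
  rw [map_mul, mul_apply_eq_comp]

theorem transport_mul (hJ : J.adjoint ∘L J = 1) (N N' : Matrix (Fin d) (Fin d) ℂ) :
    transport J N * transport J N' = transport J (N * N') := by
  ext x
  rw [mul_apply_eq_comp, transport_apply, transport_apply, transport_apply,
    adjoint_apply_apply hJ, toEuclideanCLM_mul_apply]

theorem star_transport (J : EuclideanSpace ℂ (Fin d) →L[ℂ] H) (N : Matrix (Fin d) (Fin d) ℂ) :
    star (transport J N) = transport J Nᴴ := by
  rw [ContinuousLinearMap.star_eq_adjoint, transport, transport,
    ContinuousLinearMap.adjoint_comp, ContinuousLinearMap.adjoint_comp,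
    ContinuousLinearMap.adjoint_adjoint, ← star_eq_conjTranspose, map_star,
    ContinuousLinearMap.star_eq_adjoint, ContinuousLinearMap.comp_assoc]

theorem transport_injective (hJ : J.adjoint ∘L J = 1) : Function.Injective (transport J) := by
  intro N N' h
  refine EquivLike.injective (toEuclideanCLM (n := Fin d) (𝕜 := ℂ)) ?_
  ext1 x
  have h1 := congrArg (fun T : H →L[ℂ] H => J.adjoint (T (J x))) h
  simpa only [transport_apply, adjoint_apply_apply hJ] using h1

theorem transport_nonneg (J : EuclideanSpace ℂ (Fin d) →L[ℂ] H)
    {N U : Matrix (Fin d) (Fin d) ℂ} {a : Fin d → ℝ} (h : Diagonalizes U N a)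
    (ha : ∀ i, 0 ≤ a i) : 0 ≤ transport J N := by
  rw [ContinuousLinearMap.nonneg_iff_isPositive]
  have h1 : N = U * realDiagonal (fun i => √(a i)) * (U * realDiagonal (fun i => √(a i)))ᴴ := by
    rw [conjTranspose_mul, realDiagonal_conjTranspose, mul_assoc, ← mul_assoc (realDiagonal _),
      realDiagonal_mul, ← mul_assoc, h.eq]
    congr 3
    ext i
    rw [Real.mul_self_sqrt (ha i)]
  have h2 : transport J N = (J ∘L toEuclideanCLM (n := Fin d) (𝕜 := ℂ)
      (U * realDiagonal (fun i => √(a i)))) ∘L (J ∘L toEuclideanCLM (n := Fin d) (𝕜 := ℂ)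
      (U * realDiagonal (fun i => √(a i)))).adjoint := by
    rw [ContinuousLinearMap.adjoint_comp, ← ContinuousLinearMap.star_eq_adjoint
      (toEuclideanCLM (n := Fin d) (𝕜 := ℂ) _), ← map_star, star_eq_conjTranspose]
    ext x
    conv_lhs => rw [h1]
    rw [transport_apply, toEuclideanCLM_mul_apply]
    rfl
  rw [h2]
  exact ContinuousLinearMap.isPositive_self_comp_adjoint _

/-- The modulus of an operator whose Gram operator is diagonalized by `U`. -/
theorem abs_eq_transport (hJ : J.adjoint ∘L J = 1) {T : H →L[ℂ] H}
    {N N' U : Matrix (Fin d) (Fin d) ℂ} {q c : Fin d → ℝ} (hT : star T * T = transport J N)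
    (hN : Diagonalizes U N q) (hN' : Diagonalizes U N' c) (hc : ∀ i, 0 ≤ c i)
    (hcq : ∀ i, c i * c i = q i) : CFC.abs T = transport J N' := by
  refine CFC.sqrt_unique ?_ (transport_nonneg J hN' hc)
  rw [hT, transport_mul hJ, (hN'.mul hN').eq, hN.eq]
  congr 4
  exact funext hcq

/-- Strict positivity of `a` makes the range of the operator equal to that of `J`, so compressing to
the range loses no eigenvalue; ordered eigenvalues are unique. -/
theorem eigenvalueList_transport (hJ : J.adjoint ∘L J = 1) {N U : Matrix (Fin d) (Fin d) ℂ}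
    {a : Fin d → ℝ} (h : Diagonalizes U N a) (ha : Antitone a) (ha0 : ∀ i, 0 < a i) :
    eigenvalueList (transport J N) = zeroPad a := by
  set T := transport J N with hT
  have hsym : (T : H →ₗ[ℂ] H).IsSymmetric := by
    rw [← ContinuousLinearMap.isSelfAdjoint_iff_isSymmetric, IsSelfAdjoint, hT, star_transport,
      h.isHermitian.eq]
  have hle : (T : H →ₗ[ℂ] H).range ≤ (J : EuclideanSpace ℂ (Fin d) →ₗ[ℂ] H).range := by
    rintro _ ⟨x, rfl⟩
    exact ⟨_, rfl⟩
  have hfin : FiniteDimensional ℂ (T : H →ₗ[ℂ] H).range := Submodule.finiteDimensional_of_le hle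
  have hTu : ∀ i, T (J (h.basis i)) = (a i : ℂ) • J (h.basis i) := by
    intro i
    rw [hT, transport_apply, adjoint_apply_apply hJ, h.toEuclideanCLM_basis, map_smul]
  have hmem : ∀ i, J (h.basis i) ∈ (T : H →ₗ[ℂ] H).range := by
    intro i
    refine ⟨(a i : ℂ)⁻¹ • J (h.basis i), ?_⟩
    rw [ContinuousLinearMap.coe_coe, map_smul, hTu, smul_smul, inv_mul_cancel₀, one_smul]
    exact_mod_cast (ha0 i).ne'
  have hon : Orthonormal ℂ fun i => (⟨J (h.basis i), hmem i⟩ : (T : H →ₗ[ℂ] H).range) := by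
    have h1 := h.basis.orthonormal
    rw [orthonormal_iff_ite] at h1 ⊢
    intro i j
    rw [Submodule.coe_inner, ← ContinuousLinearMap.adjoint_inner_right, adjoint_apply_apply hJ]
    exact h1 i j
  have hrank : Module.finrank ℂ (T : H →ₗ[ℂ] H).range = d := by
    refine le_antisymm ?_ ?_
    · refine (Submodule.finrank_mono hle).trans ((LinearMap.finrank_range_le _).trans ?_)
      simp
    · simpa using hon.linearIndependent.fintype_card_le_finrank
  have hspan : Submodule.span ℂ
      (Set.range fun i => (⟨J (h.basis i), hmem i⟩ : (T : H →ₗ[ℂ] H).range)) = ⊤ :=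
    hon.linearIndependent.span_eq_top_of_card_eq_finrank' (by simp [hrank])
  let u := (OrthonormalBasis.mk hon hspan.ge).reindex (finCongr hrank.symm)
  have hu : ∀ i, (u i : H) = J (h.basis (Fin.cast hrank i)) := by
    intro i
    simp [u]
  let hc := compression_isSymmetric hsym (T : H →ₗ[ℂ] H).range
  have huniq := eigenvalue_unique (hc.eigenvectorBasis rfl) u (hc.eigenvalues_antitone rfl)
    (a' := a ∘ Fin.cast hrank) (fun i j hij => ha hij)
    (fun i => hc.apply_eigenvectorBasis rfl i) (fun i => by
      apply Subtype.ext
      have h1 : T (u i : H) = (a (Fin.cast hrank i) : ℂ) • (u i : H) := by rw [hu, hTu]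
      rw [compression, LinearMap.comp_apply, LinearMap.comp_apply, Submodule.subtype_apply,
        ContinuousLinearMap.coe_coe, ContinuousLinearMap.coe_coe, h1, map_smul,
        Submodule.orthogonalProjectionOnto_mem_subspace_eq_self]
      rfl)
  funext i
  rw [eigenvalueList, dif_pos ⟨hsym, hfin⟩, zeroPad]
  by_cases hi : i < d
  · rw [dif_pos hi, dif_pos (hrank.symm ▸ hi)]
    exact congrFun huniq ⟨i, hrank.symm ▸ hi⟩
  · rw [dif_neg hi, dif_neg (fun h => hi (hrank ▸ h))]

theorem zeroPad_injective : Function.Injective (zeroPad (d := d)) := by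
  intro a b h
  funext i
  have := congrFun h i
  simpa [zeroPad] using this

theorem zeroPad_apply (a : Fin d → ℝ) (i : Fin d) : zeroPad a i = a i := by
  simp [zeroPad]

theorem adjoint_synthesis_apply {n : ℕ} (f : Fin n → H) (x : H) (i : Fin n) :
    (synthesis f).adjoint x i = ⟪f i, x⟫_ℂ := by
  have h := ContinuousLinearMap.adjoint_inner_right (synthesis f) (EuclideanSpace.single i 1) x
  rw [EuclideanSpace.inner_single_left, synthesis_apply] at h
  simpa [Pi.single_apply] using h

theorem adjoint_synthesis_comp_synthesis {f : Fin d → H} (hf : Orthonormal ℂ f) :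
    (synthesis f).adjoint ∘L synthesis f = 1 := by
  ext x i
  rw [ContinuousLinearMap.comp_apply, adjoint_synthesis_apply, synthesis_apply,
    hf.inner_right_fintype]
  rfl

theorem transport_synthesis (f : Fin d → H) (a : Fin d → ℝ) :
    transport (synthesis f) (realDiagonal a) =
      ∑ i, (a i : ℂ) • InnerProductSpace.rankOne ℂ (f i) (f i) := by
  ext x
  rw [transport_apply, synthesis_apply, _root_.sum_apply]
  refine Finset.sum_congr rfl fun i _ => ?_
  simp only [realDiagonal, ofLp_toEuclideanCLM, mulVec_diagonal, adjoint_synthesis_apply]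
  rw [_root_.smul_apply, InnerProductSpace.rankOne_apply, smul_smul]

variable {W : Submodule ℂ H} (b : OrthonormalBasis (Fin d) ℂ W)

theorem synthesis_comp_adjoint [W.HasOrthogonalProjection] :
    synthesis (fun i => (b i : H)) ∘L (synthesis (fun i => (b i : H))).adjoint =
      W.starProjection := by
  ext x
  rw [ContinuousLinearMap.comp_apply, synthesis_apply]
  simp only [adjoint_synthesis_apply]
  rw [b.starProjection_eq_sum_rankOne]
  simp

end Transport

end ObliqueDuality

namespace ObliqueDuality

open scoped InnerProductSpace ComplexOrder
open Matrix

/-! ### Orthonormal bases of the two subspaces as isometric embeddings -/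

section Subspaces

variable {H : Type*} [NormedAddCommGroup H] [InnerProductSpace ℂ H] {d : ℕ} {V W : Submodule ℂ H}

/-- Both subspaces are complements of `Wᗮ`, hence isomorphic to the quotient by it. -/
theorem finrank_eq_of_isCompl_orthogonal [W.HasOrthogonalProjection] (h : IsCompl V Wᗮ) :
    Module.finrank ℂ V = Module.finrank ℂ W :=
  LinearEquiv.finrank_eq ((Submodule.quotientEquivOfIsCompl Wᗮ V h.symm).symm.trans
    (Submodule.quotientEquivOfIsCompl Wᗮ W W.isCompl_orthogonal.symm))

/-- The synthesis operator of an orthonormal basis of a subspace. -/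
noncomputable abbrev embedding (b : OrthonormalBasis (Fin d) ℂ W) :
    EuclideanSpace ℂ (Fin d) →L[ℂ] H :=
  synthesis fun i => (b i : H)

theorem embedding_mem (b : OrthonormalBasis (Fin d) ℂ W) (x : EuclideanSpace ℂ (Fin d)) :
    embedding b x ∈ W := by
  rw [synthesis_coe_basis]
  exact Subtype.coe_prop _

theorem norm_embedding (b : OrthonormalBasis (Fin d) ℂ W) (x : EuclideanSpace ℂ (Fin d)) :
    ‖embedding b x‖ = ‖x‖ := by
  rw [synthesis_coe_basis]
  exact b.repr.symm.norm_map x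

end Subspaces

/-! ### Frames, oblique projections and principal vectors in matrix form -/

section Frames

variable {H : Type*} [NormedAddCommGroup H] [InnerProductSpace ℂ H] [CompleteSpace H] {d : ℕ}
  {V W : Submodule ℂ H}

theorem IsPseudoinverse.eq_pseudoinverse {S X : H →L[ℂ] H} (h : IsPseudoinverse S X) :
    pseudoinverse S = X := by
  have h1 : ∃ X, IsPseudoinverse S X := ⟨X, h⟩
  rw [pseudoinverse, dif_pos h1]
  exact h1.choose_spec.unique h

theorem isPseudoinverse_transport {J : EuclideanSpace ℂ (Fin d) →L[ℂ] H}
    (hJ : J.adjoint ∘L J = 1) {N : Matrix (Fin d) (Fin d) ℂ} (hN : IsUnit N.det) :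
    IsPseudoinverse (transport J N) (transport J N⁻¹) where
  mul_mul_self := by
    rw [transport_mul hJ, transport_mul hJ, mul_nonsing_inv _ hN, one_mul]
  self_mul_mul := by
    rw [transport_mul hJ, transport_mul hJ, nonsing_inv_mul _ hN, one_mul]
  isSelfAdjoint_left := by
    rw [transport_mul hJ, mul_nonsing_inv _ hN, IsSelfAdjoint, star_transport, conjTranspose_one]
  isSelfAdjoint_right := by
    rw [transport_mul hJ, nonsing_inv_mul _ hN, IsSelfAdjoint, star_transport, conjTranspose_one]

theorem adjoint_comp_embedding (b : OrthonormalBasis (Fin d) ℂ W) :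
    (embedding b).adjoint ∘L embedding b = 1 :=
  adjoint_synthesis_comp_synthesis (orthonormal_coe b)

theorem embedding_adjoint_of_mem [W.HasOrthogonalProjection] (b : OrthonormalBasis (Fin d) ℂ W)
    {x : H} (hx : x ∈ W) : embedding b ((embedding b).adjoint x) = x := by
  rw [← ContinuousLinearMap.comp_apply, synthesis_comp_adjoint,
    Submodule.starProjection_eq_self_iff.2 hx]

theorem norm_adjoint_embedding_le (b : OrthonormalBasis (Fin d) ℂ W) (x : H) :
    ‖(embedding b).adjoint x‖ ≤ ‖x‖ := by
  have h : ‖(embedding b).adjoint‖ ≤ 1 := by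
    rw [LinearIsometryEquiv.norm_map]
    exact ContinuousLinearMap.opNorm_le_bound _ zero_le_one fun y => by
      rw [norm_embedding, one_mul]
  simpa using (embedding b).adjoint.le_of_opNorm_le h x

theorem mem_orthogonal_of_adjoint_embedding_eq_zero [W.HasOrthogonalProjection]
    (b : OrthonormalBasis (Fin d) ℂ W) {x : H} (hx : (embedding b).adjoint x = 0) : x ∈ Wᗮ := by
  rw [← Submodule.starProjection_apply_eq_zero_iff, ← synthesis_comp_adjoint b,
    ContinuousLinearMap.comp_apply, hx, map_zero]

/-- The matrix of inner products of two orthonormal bases. -/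
noncomputable def crossGram (b : OrthonormalBasis (Fin d) ℂ W) (v : OrthonormalBasis (Fin d) ℂ V) :
    Matrix (Fin d) (Fin d) ℂ :=
  (toEuclideanCLM (n := Fin d) (𝕜 := ℂ)).symm ((embedding b).adjoint ∘L embedding v)

theorem toEuclideanCLM_crossGram (b : OrthonormalBasis (Fin d) ℂ W)
    (v : OrthonormalBasis (Fin d) ℂ V) :
    toEuclideanCLM (n := Fin d) (𝕜 := ℂ) (crossGram b v) =
      (embedding b).adjoint ∘L embedding v := by
  simp [crossGram]

theorem crossGram_conjTranspose (b : OrthonormalBasis (Fin d) ℂ W)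
    (v : OrthonormalBasis (Fin d) ℂ V) : (crossGram b v)ᴴ = crossGram v b := by
  refine EquivLike.injective (toEuclideanCLM (n := Fin d) (𝕜 := ℂ)) ?_
  rw [← star_eq_conjTranspose, map_star, toEuclideanCLM_crossGram, toEuclideanCLM_crossGram,
    ContinuousLinearMap.star_eq_adjoint, ContinuousLinearMap.adjoint_comp,
    ContinuousLinearMap.adjoint_adjoint]

theorem isUnit_det_of_injective {N : Matrix (Fin d) (Fin d) ℂ}
    (h : ∀ x, toEuclideanCLM (n := Fin d) (𝕜 := ℂ) N x = 0 → x = 0) : IsUnit N.det := by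
  rw [← isUnit_iff_isUnit_det, ← mulVec_injective_iff_isUnit]
  refine (injective_iff_map_eq_zero N.mulVecLin).2 fun x hx => ?_
  have := h (WithLp.toLp 2 x) (by
    rw [toEuclideanCLM_toLp]
    exact congrArg (WithLp.toLp 2) hx)
  simpa using this

/-- A kernel vector would give an element of `V` orthogonal to `W`, which is zero. -/
theorem isUnit_det_crossGram [W.HasOrthogonalProjection] (hVW : IsCompl V Wᗮ)
    (b : OrthonormalBasis (Fin d) ℂ W) (v : OrthonormalBasis (Fin d) ℂ V) :
    IsUnit (crossGram b v).det := by
  refine isUnit_det_of_injective fun x hx => ?_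
  rw [toEuclideanCLM_crossGram, ContinuousLinearMap.comp_apply] at hx
  have h1 := Submodule.disjoint_def.1 hVW.disjoint _ (embedding_mem v x)
    (mem_orthogonal_of_adjoint_embedding_eq_zero b hx)
  rw [← norm_eq_zero, norm_embedding] at h1
  exact norm_eq_zero.1 h1

/-- The candidate lies in `V` and has the same coordinates along `W` as `x`, so it differs from `x`
by an element of `Wᗮ`. -/
theorem projection_eq_embedding [W.HasOrthogonalProjection] (hVW : IsCompl V Wᗮ)
    (b : OrthonormalBasis (Fin d) ℂ W) (v : OrthonormalBasis (Fin d) ℂ V) (x : H) :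
    V.projection Wᗮ hVW x = embedding v (toEuclideanCLM (n := Fin d) (𝕜 := ℂ) (crossGram b v)⁻¹
      ((embedding b).adjoint x)) := by
  set y := embedding v (toEuclideanCLM (n := Fin d) (𝕜 := ℂ) (crossGram b v)⁻¹
      ((embedding b).adjoint x)) with hy
  have h1 : (embedding b).adjoint y = (embedding b).adjoint x := by
    rw [hy, ← ContinuousLinearMap.comp_apply, ← toEuclideanCLM_crossGram,
      ← toEuclideanCLM_mul_apply, mul_nonsing_inv _ (isUnit_det_crossGram hVW b v), map_one]
    rfl
  have h2 : x - y ∈ Wᗮ := mem_orthogonal_of_adjoint_embedding_eq_zero b (by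
    rw [map_sub, h1, sub_self])
  have h3 : V.projection Wᗮ hVW (x - y) = 0 := (Submodule.projection_apply_eq_zero_iff hVW).2 h2
  rw [map_sub, Submodule.projection_apply_of_mem_left hVW (embedding_mem v _), sub_eq_zero] at h3
  exact h3

theorem star_mul_starProjection [W.HasOrthogonalProjection] [V.HasOrthogonalProjection]
    (b : OrthonormalBasis (Fin d) ℂ W) (v : OrthonormalBasis (Fin d) ℂ V) :
    star (V.starProjection * W.starProjection) * (V.starProjection * W.starProjection) =
      transport (embedding b) (crossGram b v * (crossGram b v)ᴴ) := by
  rw [star_mul, (isSelfAdjoint_starProjection V).star_eq, (isSelfAdjoint_starProjection W).star_eq,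
    mul_assoc, ← mul_assoc V.starProjection, V.isIdempotentElem_starProjection.eq]
  ext x
  rw [transport_apply, crossGram_conjTranspose, toEuclideanCLM_mul_apply, toEuclideanCLM_crossGram,
    toEuclideanCLM_crossGram, ← synthesis_comp_adjoint b, ← synthesis_comp_adjoint v]
  rfl

/-- The frame operator of a frame for `W` is given by a positive definite matrix. -/
theorem IsFrameFor.exists_posDef [W.HasOrthogonalProjection] {n : ℕ} {f : Fin n → H}
    (hf : IsFrameFor W f) (b : OrthonormalBasis (Fin d) ℂ W) :
    ∃ s : Matrix (Fin d) (Fin d) ℂ, s.PosDef ∧ frameOperator f = transport (embedding b) s := by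
  obtain ⟨hmem, A, B, hA, -, hAB⟩ := hf
  let s := (toEuclideanCLM (n := Fin d) (𝕜 := ℂ)).symm
    (((embedding b).adjoint ∘L synthesis f) ∘L ((embedding b).adjoint ∘L synthesis f).adjoint)
  have hs : toEuclideanCLM (n := Fin d) (𝕜 := ℂ) s = ((embedding b).adjoint ∘L synthesis f) ∘L
      ((embedding b).adjoint ∘L synthesis f).adjoint := by simp [s]
  have hsyn : embedding b ∘L (embedding b).adjoint ∘L synthesis f = synthesis f := by
    ext x
    refine embedding_adjoint_of_mem b ?_
    rw [ContinuousLinearMap.coe_coe, synthesis_apply]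
    exact Submodule.sum_mem _ fun i _ => W.smul_mem _ (hmem i)
  refine ⟨s, ?_, ?_⟩
  · refine PosDef.of_dotProduct_mulVec_pos ?_ fun x hx => ?_
    · rw [IsHermitian, ← star_eq_conjTranspose]
      refine EquivLike.injective (toEuclideanCLM (n := Fin d) (𝕜 := ℂ)) ?_
      rw [map_star, hs, ContinuousLinearMap.star_eq_adjoint, ContinuousLinearMap.adjoint_comp,
        ContinuousLinearMap.adjoint_adjoint]
    · have h1 := inner_toEuclideanCLM_self s (WithLp.toLp 2 x)
      rw [← h1, hs, ContinuousLinearMap.comp_apply, ← ContinuousLinearMap.adjoint_inner_left,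
        inner_self_eq_norm_sq_to_K, ContinuousLinearMap.adjoint_comp,
        ContinuousLinearMap.adjoint_adjoint, ContinuousLinearMap.comp_apply]
      -- Definiteness is the lower frame bound.
      have h2 : 0 < ‖(synthesis f).adjoint (embedding b (WithLp.toLp 2 x))‖ ^ 2 := by
        rw [EuclideanSpace.norm_sq_eq]
        simp only [adjoint_synthesis_apply]
        refine lt_of_lt_of_le ?_ (hAB _ (embedding_mem b _)).1
        rw [norm_embedding]
        have : 0 < ‖WithLp.toLp 2 x‖ := norm_pos_iff.2 fun h => hx (by simpa using h)
        positivity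
      rw [← RCLike.ofReal_pow]
      exact RCLike.ofReal_pos.2 h2
  · conv_lhs => rw [frameOperator, ← hsyn]
    rw [transport, hs, ContinuousLinearMap.adjoint_comp]
    simp only [ContinuousLinearMap.comp_assoc]

theorem frameOperator_canonicalDual [W.HasOrthogonalProjection] (hVW : IsCompl V Wᗮ)
    (b : OrthonormalBasis (Fin d) ℂ W) (v : OrthonormalBasis (Fin d) ℂ V) {n : ℕ} {f : Fin n → H}
    {s : Matrix (Fin d) (Fin d) ℂ} (hs : s.PosDef)
    (hf : frameOperator f = transport (embedding b) s) :
    frameOperator (canonicalDual hVW f) = transport (embedding v)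
      ((crossGram b v)⁻¹ * s⁻¹ * ((crossGram b v)⁻¹)ᴴ) := by
  set G := crossGram b v
  have hsu : IsUnit s.det := (isUnit_iff_isUnit_det s).1 hs.isUnit
  have hJ := adjoint_comp_embedding b
  set K : H →L[ℂ] H := embedding v ∘L
    toEuclideanCLM (n := Fin d) (𝕜 := ℂ) (G⁻¹ * s⁻¹) ∘L (embedding b).adjoint with hK
  have hdual : synthesis (canonicalDual hVW f) = K ∘L synthesis f := by
    ext x
    rw [synthesis_apply, ContinuousLinearMap.comp_apply, synthesis_apply, map_sum]
    refine Finset.sum_congr rfl fun i _ => ?_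
    rw [map_smul, canonicalDual, hf, (isPseudoinverse_transport hJ hsu).eq_pseudoinverse,
      projection_eq_embedding hVW b v, transport_apply, adjoint_apply_apply hJ,
      ← toEuclideanCLM_mul_apply]
    rfl
  have hKadj : K.adjoint = embedding b ∘L
      toEuclideanCLM (n := Fin d) (𝕜 := ℂ) (G⁻¹ * s⁻¹)ᴴ ∘L (embedding v).adjoint := by
    rw [hK, ContinuousLinearMap.adjoint_comp, ContinuousLinearMap.adjoint_comp,
      ContinuousLinearMap.adjoint_adjoint, ← star_eq_conjTranspose, map_star,
      ContinuousLinearMap.star_eq_adjoint, ContinuousLinearMap.comp_assoc]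
  have h1 : frameOperator (canonicalDual hVW f) = K ∘L frameOperator f ∘L K.adjoint := by
    rw [frameOperator, hdual, ContinuousLinearMap.adjoint_comp, frameOperator]
    simp only [ContinuousLinearMap.comp_assoc]
  -- Since the dual is the image of the frame under `K`, its frame operator is `K S K*`; one factor
  -- `s⁻¹` cancels against `s`.
  have h2 : G⁻¹ * s⁻¹ * (G⁻¹)ᴴ = G⁻¹ * s⁻¹ * (s * (G⁻¹ * s⁻¹)ᴴ) := by
    rw [conjTranspose_mul, conjTranspose_nonsing_inv s, hs.isHermitian.eq, ← mul_assoc s,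
      mul_nonsing_inv _ hsu, one_mul]
  rw [h1, hf, hKadj, h2]
  ext x
  rw [transport_apply, toEuclideanCLM_mul_apply (G⁻¹ * s⁻¹), toEuclideanCLM_mul_apply s]
  simp only [hK, ContinuousLinearMap.comp_apply, transport_apply, adjoint_apply_apply hJ]

theorem transport_comp (J : EuclideanSpace ℂ (Fin d) →L[ℂ] H) (Z N : Matrix (Fin d) (Fin d) ℂ) :
    transport (J ∘L toEuclideanCLM (n := Fin d) (𝕜 := ℂ) Z) N = transport J (Z * N * Zᴴ) := by
  ext x
  rw [transport_apply, transport_apply, ContinuousLinearMap.adjoint_comp,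
    toEuclideanCLM_mul_apply, toEuclideanCLM_mul_apply, ← star_eq_conjTranspose, map_star,
    ContinuousLinearMap.star_eq_adjoint]
  rfl

theorem conjTranspose_crossGram_mul_self [W.HasOrthogonalProjection]
    (b w : OrthonormalBasis (Fin d) ℂ W) : (crossGram b w)ᴴ * crossGram b w = 1 := by
  refine EquivLike.injective (toEuclideanCLM (n := Fin d) (𝕜 := ℂ)) ?_
  rw [map_one]
  ext1 x
  rw [toEuclideanCLM_mul_apply, crossGram_conjTranspose, toEuclideanCLM_crossGram,
    toEuclideanCLM_crossGram, ContinuousLinearMap.comp_apply, ContinuousLinearMap.comp_apply,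
    embedding_adjoint_of_mem b (embedding_mem w x),
    adjoint_apply_apply (adjoint_comp_embedding w)]
  rfl

theorem embedding_comp_crossGram [W.HasOrthogonalProjection]
    (b w : OrthonormalBasis (Fin d) ℂ W) :
    embedding b ∘L toEuclideanCLM (n := Fin d) (𝕜 := ℂ) (crossGram b w) = embedding w := by
  ext1 x
  rw [toEuclideanCLM_crossGram]
  exact embedding_adjoint_of_mem b (embedding_mem w x)

/-- Orthonormal bases of `W` correspond to unitary matrices through their coordinates in `b`.
Principal vectors are eigenvectors of the modulus, whose matrix is the positive square root of `G *
Gᴴ` and so has the same eigenvectors. -/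
theorem exists_isPrincipalBasis_iff [W.HasOrthogonalProjection] [V.HasOrthogonalProjection]
    (b : OrthonormalBasis (Fin d) ℂ W) (v : OrthonormalBasis (Fin d) ℂ V)
    {s U : Matrix (Fin d) (Fin d) ℂ} {S : H →L[ℂ] H} (hS : S = transport (embedding b) s)
    {q : Fin d → ℝ} (hq : Diagonalizes U (crossGram b v * (crossGram b v)ᴴ) q)
    (hc : ∀ j : Fin d, 0 ≤ Real.cos (principalAngle V W j))
    (hcq : ∀ j : Fin d, Real.cos (principalAngle V W j) * Real.cos (principalAngle V W j) = q j)
    (m : Fin d → ℝ) :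
    (∃ w : OrthonormalBasis (Fin d) ℂ W, IsPrincipalBasis V W w ∧
        S = ∑ j, (m j : ℂ) • InnerProductSpace.rankOne ℂ (w j : H) (w j : H)) ↔
      ∃ Z, Diagonalizes Z s m ∧ Diagonalizes Z (crossGram b v * (crossGram b v)ᴴ) q := by
  set c : Fin d → ℝ := fun j => Real.cos (principalAngle V W j)
  have hJ := adjoint_comp_embedding b
  have habs : ∀ {Z N' : Matrix (Fin d) (Fin d) ℂ},
      Diagonalizes Z (crossGram b v * (crossGram b v)ᴴ) q → Diagonalizes Z N' c →
      CFC.abs (V.starProjection * W.starProjection) = transport (embedding b) N' :=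
    fun h h' => abs_eq_transport hJ (star_mul_starProjection b v) h h' hc hcq
  constructor
  · rintro ⟨w, hw, hSw⟩
    have hZ := conjTranspose_crossGram_mul_self b w
    refine ⟨crossGram b w, ⟨hZ, ?_⟩, ?_⟩
    · refine transport_injective hJ ?_
      rw [← transport_comp, embedding_comp_crossGram, transport_synthesis, ← hS, hSw]
    -- `N'` is the square root of `G * Gᴴ`; the principal vector equations say that `crossGram b w`
    -- diagonalizes `N'`, and squaring gives the claim.
    · obtain ⟨N', hN'⟩ : ∃ N', Diagonalizes U N' c := ⟨_, hq.unitary, rfl⟩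
      have hab := habs hq hN'
      have h1 : Diagonalizes (crossGram b w) N' c := by
        refine .of_mul_eq hZ (EquivLike.injective (toEuclideanCLM (n := Fin d) (𝕜 := ℂ)) ?_)
        apply ContinuousLinearMap.coe_injective
        refine (EuclideanSpace.basisFun (Fin d) ℂ).toBasis.ext fun j => ?_
        have h2 := hw j
        rw [hab, transport_apply, ← synthesis_single (fun i => (w i : H)) j] at h2
        have h3 := congrArg (embedding b).adjoint h2
        rw [adjoint_apply_apply hJ, map_smul] at h3
        have h4 : toEuclideanCLM (n := Fin d) (𝕜 := ℂ) (realDiagonal c) (EuclideanSpace.single j 1)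
            = (c j : ℂ) • EuclideanSpace.single j 1 := by
          ext i
          simp only [realDiagonal, ofLp_toEuclideanCLM, mulVec_diagonal, PiLp.smul_apply,
            PiLp.single_apply, smul_eq_mul]
          split_ifs with hij
          · rw [hij]
          · simp
        rw [OrthonormalBasis.coe_toBasis, EuclideanSpace.basisFun_apply,
          ContinuousLinearMap.coe_coe, ContinuousLinearMap.coe_coe, toEuclideanCLM_mul_apply N',
          toEuclideanCLM_mul_apply (crossGram b w), h4, map_smul, toEuclideanCLM_crossGram]
        exact h3
      have h2 : crossGram b v * (crossGram b v)ᴴ = N' * N' := by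
        rw [(hN'.mul hN').eq, hq.eq]
        congr 3
        exact (funext hcq).symm
      rw [h2]
      convert h1.mul h1 using 1
      exact (funext hcq).symm
  · rintro ⟨Z, hZs, hZq⟩
    obtain ⟨N', hN'⟩ : ∃ N', Diagonalizes Z N' c := ⟨_, hZq.unitary, rfl⟩
    have hab := habs hZq hN'
    let w := hN'.basis.map b.repr.symm
    have hw : ∀ j, (w j : H) = embedding b (hN'.basis j) := fun j => by
      rw [synthesis_coe_basis]
      rfl
    have hemb : embedding w = embedding b ∘L toEuclideanCLM (n := Fin d) (𝕜 := ℂ) Z := by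
      apply ContinuousLinearMap.coe_injective
      refine (EuclideanSpace.basisFun (Fin d) ℂ).toBasis.ext fun j => ?_
      rw [OrthonormalBasis.coe_toBasis, EuclideanSpace.basisFun_apply,
        ContinuousLinearMap.coe_coe, ContinuousLinearMap.coe_coe, synthesis_single,
        ContinuousLinearMap.comp_apply, hw, hN'.basis_apply]
    refine ⟨w, fun j => ?_, ?_⟩
    · rw [hab, hw, transport_apply, adjoint_apply_apply hJ, hN'.toEuclideanCLM_basis, map_smul]
    · rw [hS, ← transport_synthesis, ← embedding, hemb, transport_comp, hZs.eq]

/-- `G * Gᴴ` is a product of contractions. This makes the square roots of `q` genuine cosines. -/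
theorem diagonalizes_crossGram_le_one {U : Matrix (Fin d) (Fin d) ℂ} {q : Fin d → ℝ}
    (b : OrthonormalBasis (Fin d) ℂ W) (v : OrthonormalBasis (Fin d) ℂ V)
    (hq : Diagonalizes U (crossGram b v * (crossGram b v)ᴴ) q) (i : Fin d) : q i ≤ 1 := by
  have h1 := congrArg norm (hq.toEuclideanCLM_basis i)
  generalize hq.basis = u at h1
  rw [norm_smul, u.norm_eq_one, mul_one, Complex.norm_real, toEuclideanCLM_mul_apply,
    crossGram_conjTranspose, toEuclideanCLM_crossGram, toEuclideanCLM_crossGram] at h1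
  calc q i ≤ ‖q i‖ := Real.le_norm_self _
    _ = _ := h1.symm
    _ ≤ ‖embedding v ((embedding v).adjoint (embedding b (u i)))‖ :=
      norm_adjoint_embedding_le b _
    _ ≤ ‖embedding b (u i)‖ := by
      rw [norm_embedding]
      exact norm_adjoint_embedding_le v _
    _ = 1 := by rw [norm_embedding, u.norm_eq_one]

end Frames

theorem prod_filter_val_lt {d k : ℕ} (hk : k ≤ d) (F : ℕ → ℝ) :
    ∏ j : Fin d with j.val < k, F j = ∏ j ∈ Finset.range k, F j := by
  refine Finset.prod_bij (fun j _ => j.val) (fun j hj => by simpa using hj)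
    (fun i _ j _ h => Fin.ext h) (fun j hj => ?_) fun _ _ => rfl
  exact ⟨⟨j, (Finset.mem_range.1 hj).trans_le hk⟩, by simpa using hj, rfl⟩

theorem prod_filter_val_lt_rev {d k : ℕ} (hk : k ≤ d) (F : ℕ → ℝ) :
    ∏ j : Fin d with j.val < k, F j.rev = ∏ j ∈ Finset.Ico (d - k) d, F j := by
  refine Finset.prod_bij (fun j _ => j.rev.val) (fun j hj => ?_)
    (fun i _ j _ h => Fin.rev_injective (Fin.ext h)) (fun j hj => ?_) fun _ _ => rfl
  · have := (Finset.mem_filter.1 hj).2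
    rw [Finset.mem_Ico, Fin.val_rev]
    omega
  · have := Finset.mem_Ico.1 hj
    refine ⟨⟨d - 1 - j, by omega⟩, ?_, ?_⟩
    · simp only [Finset.mem_filter, Finset.mem_univ, true_and]
      omega
    · rw [Fin.val_rev]
      simp only
      omega

end ObliqueDuality

/-! ### The main theorem -/

open ObliqueDuality in
theorem theorem4p3 {H : Type*} [NormedAddCommGroup H] [InnerProductSpace ℂ H] [CompleteSpace H]
    (V W : Submodule ℂ H) [FiniteDimensional ℂ V] [FiniteDimensional ℂ W]
    (hVW : IsCompl V Wᗮ) (d : ℕ) (hd : Module.finrank ℂ W = d)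
    (n : ℕ) (f : Fin n → H) (hf : IsFrameFor W f)
    (lam lamV θ : ℕ → ℝ)
    (hlam : lam = eigenvalueList (frameOperator f))
    (hlamV : lamV = eigenvalueList (frameOperator (canonicalDual hVW f)))
    (hθ : θ = principalAngle V W)
    (μ ν : Fin d → ℝ)
    (hμ : μ = decreasingRearrangement
      (fun j : Fin d => (lam j.rev)⁻¹ * (Real.cos (θ j) ^ 2)⁻¹))
    (hν : ν = fun j : Fin d => (lam j.rev)⁻¹ * (Real.cos (θ j.rev) ^ 2)⁻¹) :
    (∀ j : Fin d, 0 < lam j ∧ 0 ≤ θ j ∧ θ j < Real.pi / 2) ∧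
    (∀ k ∈ Finset.Icc 1 d,
      ∏ j : Fin d with j.val < k, μ j ≤ ∏ j ∈ Finset.range k, lamV j ∧
      ∏ j ∈ Finset.range k, lamV j ≤
        (∏ j ∈ Finset.Ico (d - k) d, lam j * Real.cos (θ j) ^ 2)⁻¹) ∧
    (lamV = zeroPad μ ↔
      ∃ w : OrthonormalBasis (Fin d) ℂ W, IsPrincipalBasis V W w ∧
        frameOperator f = ∑ j : Fin d, ((lam j.rev : ℝ) : ℂ) •
          InnerProductSpace.rankOne ℂ (w j : H) (w j : H)) ∧
    (lamV = zeroPad ν ↔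
      ∃ w : OrthonormalBasis (Fin d) ℂ W, IsPrincipalBasis V W w ∧
        frameOperator f = ∑ j : Fin d, ((lam j : ℝ) : ℂ) •
          InnerProductSpace.rankOne ℂ (w j : H) (w j : H)) := by
  have hVd : Module.finrank ℂ V = d := (finrank_eq_of_isCompl_orthogonal hVW).trans hd
  obtain ⟨b⟩ : Nonempty (OrthonormalBasis (Fin d) ℂ W) :=
    ⟨(stdOrthonormalBasis ℂ W).reindex (finCongr hd)⟩
  obtain ⟨v⟩ : Nonempty (OrthonormalBasis (Fin d) ℂ V) :=
    ⟨(stdOrthonormalBasis ℂ V).reindex (finCongr hVd)⟩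
  have hJw := adjoint_comp_embedding b
  have hJv := adjoint_comp_embedding v
  obtain ⟨s, hs, hfs⟩ := hf.exists_posDef b
  have hG := isUnit_det_crossGram hVW b v
  have hdual := frameOperator_canonicalDual hVW b v hs hfs
  -- The angles are defined by `|P_W P_V|`, which lives on `V` and has Gram matrix `Gᴴ * G`, while
  -- principal vectors use `|P_V P_W|` and `G * Gᴴ`; hence the swapped roles.
  have hGG := star_mul_starProjection v b
  rw [crossGram_conjTranspose, ← crossGram_conjTranspose b v] at hGG
  obtain ⟨Us, l, hl, hla, hl0⟩ := exists_diagonalizes_of_posDef hs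
  obtain ⟨Uq, q, hq, hqa, hq0⟩ := exists_diagonalizes_of_posDef (posDef_mul_conjTranspose hG)
  obtain ⟨Uq', hq'⟩ := exists_diagonalizes_conjTranspose_mul_self hq hq0
  obtain ⟨Up, p, hp, hpa, hp0⟩ := exists_diagonalizes_of_posDef (posDef_dual hG hs)
  have hlam' : lam = zeroPad l := by rw [hlam, hfs, eigenvalueList_transport hJw hl hla hl0]
  have hlamV' : lamV = zeroPad p := by rw [hlamV, hdual, eigenvalueList_transport hJv hp hpa hp0]
  have hlj : ∀ j : Fin d, lam j = l j := fun j => by rw [hlam', zeroPad_apply]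
  have hθj : ∀ j : Fin d, θ j = Real.arccos √(q j) := by
    intro j
    have hc : Diagonalizes Uq' (Uq' * realDiagonal (fun i => √(q i)) * Uq'.conjTranspose)
      fun i => √(q i) := ⟨hq'.unitary, rfl⟩
    rw [hθ, principalAngle, abs_eq_transport hJv hGG hq' hc (fun i => Real.sqrt_nonneg _)
      (fun i => Real.mul_self_sqrt (hq0 i).le), eigenvalueList_transport hJv hc
      (fun i j hij => Real.sqrt_le_sqrt (hqa hij)) (fun i => Real.sqrt_pos.2 (hq0 i)),
      zeroPad_apply]
  have hcos : ∀ j : Fin d, Real.cos (θ j) = √(q j) := fun j => by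
    rw [hθj, Real.cos_arccos (by linarith [Real.sqrt_nonneg (q j)])
      (Real.sqrt_le_one.2 (diagonalizes_crossGram_le_one b v hq j))]
  have hcosq : ∀ j : Fin d, Real.cos (θ j) ^ 2 = q j := fun j => by
    rw [hcos, Real.sq_sqrt (hq0 j).le]
  have hiff := exists_isPrincipalBasis_iff b v hfs hq (fun j => by rw [← hθ, hcos]; exact Real.sqrt_nonneg _)
    (fun j => by rw [← hθ, ← sq, hcosq])
  simp only [hlj, hcosq] at hμ hν ⊢
  refine ⟨fun j => ⟨hl0 j, ?_, ?_⟩, fun k hk => ?_, ?_, ?_⟩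
  · rw [hθj]
    exact Real.arccos_nonneg _
  · rw [hθj, Real.arccos_lt_pi_div_two]
    exact Real.sqrt_pos.2 (hq0 j)
  · have hkd := (Finset.mem_Icc.1 hk).2
    have hprodV : ∏ j ∈ Finset.range k, lamV j = ∏ j : Fin d with j.val < k, p j := by
      rw [← prod_filter_val_lt hkd]
      simp only [hlamV', zeroPad_apply]
    rw [hprodV]
    constructor
    · set g : Fin d → ℝ := fun j => (l j.rev)⁻¹ * (q j)⁻¹
      -- The index set is the image of the first `k` indices under the sorting permutation, where
      -- `g` takes its `k` largest values.
      have h := le_prod_eigenvalues_dual hG hl hq hp hla hqa hpa hl0 hq0 hp0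
        ((Finset.univ.filter fun j : Fin d => j.val < k).map
          (Fin.revPerm.trans (Tuple.sort g)).toEmbedding)
      rw [Finset.prod_map, Finset.card_map, Fin.card_filter_val_lt, min_eq_right hkd] at h
      rw [hμ]
      exact h
    · refine (prod_eigenvalues_dual_le hG hl hq hp hla hqa hpa hl0 hq0 hkd).trans_eq ?_
      rw [← prod_filter_val_lt_rev hkd fun j => lam j * Real.cos (θ j) ^ 2]
      simp only [hlj, hcosq]
  · rw [hlamV', zeroPad_injective.eq_iff, hμ,
      eq_decreasingRearrangement_iff hl hq hp hla hqa hpa hl0 hq0]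
    exact (hiff _).symm
  · rw [hlamV', zeroPad_injective.eq_iff, hν,
      eq_prod_sorted_iff hl hq hp hla hqa hpa hl0 hq0]
    exact (hiff _).symm
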